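/- **Setting.** Let $n\ge 2$. *Network, leader, communication.* $N$ followers are joined by an undirected graph with adjacency matrix $\mathcal A=[a_{ij}]$ (symmetric, nonnegative, zero diagonal) and Laplacian $\mathcal L$; $b_i\ge 0$ is the weight of the link from the leader to follower $i$, and $\mathcal B=\mathrm{diag}(b_1,\dots,b_N)$. The leader signal $z_r$ is $n$ times continuously differentiable with $|z_r^{(l)}(t)|\le c_z$ for $1\le l\le n$, $t\ge 0$, where $c_z>0$; put $\bar z_r=(z_r,z_r',\dots,z_r^{(n-1)})^{\rm T}$. Communication is ON on $[\tau^{[\kappa]},\tau^{[\kappa,e]})$ and OFF on $[\tau^{[\kappa,e]},\tau^{[\kappa+1]})$, $\kappa=0,1,2,\dots$, where $\tau^{[0]}=0$, $\tau^{[\kappa]}\le\tau^{[\kappa,e]}\le\tau^{[\kappa+1]}$, $0<\tau^{[\kappa+1]}-\tau^{[\kappa]}\le T$, $\tau^{[\kappa]}\to\infty$. *Auxiliary trajectories.* Let $A$ be the $n\times n$ matrix with ones on the superdiagonal and zeros elsewhere and $B=(0,\dots,0,1)^{\rm T}$. Let $P$ be a positive definite matrix with $A^{\rm T}P+PA-2PBB^{\rm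 T}P+c_1I<0$ and $A^{\rm T}P+PA-c_3P<0$, $c_1,c_3>0$; let $c_0$ be a positive integer with $c_0\lambda_{\min}(\mathcal L+\mathcal B)\ge 1$, let $K=c_0B^{\rm T}P$ and $c_2>0$, and, with the spectral norm $\|P\|$, put $$\delta_\alpha=\frac{c_1-c_zN\|P\|/c_2}{\|P\|},\qquad \delta_\beta=c_3+\frac{c_zN}{c_2}.$$ Assume $(\delta_\alpha+\delta_\beta)(\tau^{[\kappa,e]}-\tau^{[\kappa]})-\delta_\beta(\tau^{[\kappa+1]}-\tau^{[\kappa]})>0$ for all $\kappa$. Let $\eta_1,\dots,\eta_N$ be continuous on $[0,\infty)$ with $\dot\eta_i=A\eta_i+BK\zeta_i$ (right derivative at the switching instants), where $\zeta_i=\sum_j a_{ij}(\eta_j-\eta_i)+b_i(\bar z_r-\eta_i)$ in ON mode and $\zeta_i=0$ in OFF mode. *Agents.* On a filtered probability space, for each $i$ let $\xi_i$ be an $\mathbb R^m$-valued continuous, adapted, zero-mean process with $\sup_{t\ge0}E\|\xi_i(t)\|^2\le\xi_i^*<\infty$, $\xi_i^*>0$. With $\bar x_{i,q}=(x_{i,1},\dots,x_{i,q})$,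 agent $i$ is $$\dot x_{i,q}=x_{i,q+1}+f_{i,q}(\bar x_{i,q})+g_{i,q}^{\rm T}(\bar x_{i,q})\xi_i\ (1\le q<n),\qquad \dot x_{i,n}=u_i+f_{i,n}(\bar x_{i,n})+g_{i,n}^{\rm T}(\bar x_{i,n})\xi_i,\qquad z_i=x_{i,1},$$ with $f_{i,q}:\mathbb R^q\to\mathbb R$ smooth and $g_{i,q}:\mathbb R^q\to\mathbb R^m$ differentiable and locally Lipschitz. *Control.* Let $\mathcal K_{i,q},\rho_{i,q},\gamma_{i,q},\sigma_{i,q}>0$ be arbitrary. Let $\varphi_{i,q}$ be a vector of Gaussian functions $\exp(-\|Z_{i,q}-\mu\|^2/w^2)$ of an input vector $Z_{i,q}$ that is a $C^1$ function of $(x_i,\hat\theta_i,\eta_i)$. Put $e_{i,1}=x_{i,1}-\eta_{i,1}$, $e_{i,q}=x_{i,q}-\alpha_{i,q-1}$ for $2\le q\le n$, and $$\alpha_{i,q}=-\big(\mathcal K_{i,q}+\tfrac{\rho_{i,q}^2}{2}\|g_{i,q}\|^2\big)e_{i,q}-\hat\theta_{i,q}^{\rm T}\varphi_{i,q},\qquad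 u_i=\alpha_{i,n},\qquad \dot{\hat\theta}_{i,q}=\gamma_{i,q}(e_{i,q}\varphi_{i,q}-\sigma_{i,q}\hat\theta_{i,q}),\quad 1\le q\le n.$$ *Neural approximation.* Let $S_i$ be a set of (deterministic) initial conditions $(x_i(0),\hat\theta_i(0))$, for instance all of them. Suppose that there are constant weights $\theta_{i,q}$ and constants $\epsilon^*_{i,q}$ such that, along every closed-loop trajectory starting in $S_i$ (for every noise path, on whatever time interval $[0,b)$ it exists), the functions $\bar f_{i,1}=f_{i,1}-\eta_{i,2}$ and $\bar f_{i,q}=f_{i,q}-\dot\alpha_{i,q-1}$ ($q\ge2$) satisfy $\bar f_{i,q}=\theta_{i,q}^{\rm T}\varphi_{i,q}+\epsilon_{i,q}$ with $|\epsilon_{i,q}|^2\le\epsilon_{i,q}^*$. **Theorem.** For every agent $i$: 1. for every initial condition in $S_i$ the closed loop has a unique solution $(x_i,\hat\theta_i)$ on $[0,\infty)$ for every noise path, and it is an adapted process; 2. the vector $E_i=(e_{i,1},\dots,e_{i,n},\theta_{i,1}-\hat\theta_{i,1},\dots,\theta_{i,n}-\hat\theta_{i,n})$ of errors is noise-to-state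 practically stable in probability: there are $l^{[a]}>0$, $l^{[b]}\ge0$ such that for every $l_0>0$ there are a class-$\mathcal{KL}$ function $r$ and a class-$\mathcal K$ function $d$ with $$P\big(\|E_i(t)\|\le r(\|E_i(0)\|,t)+d(l^{[a]}\xi_i^*+l^{[b]})\big)\ge 1-l_0$$ for all initial conditions in $S_i$ and all $t\ge0$; 3. there is a constant $\varepsilon_{i,v}>0$ with $\limsup_{t\to\infty}E|z_i(t)-z_r(t)|<\varepsilon_{i,v}$ for all initial conditions in $S_i$. -/

import Mathlib

open MeasureTheory Filter Topology Set

noncomputable section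

namespace IntermittentMAS

/-! ### Communication graph and leader -/

/-- `a` is the weighted adjacency matrix of an undirected graph on the followers, and `b i ≥ 0`
is the weight of the link from the leader to follower `i` (`0` if there is none). -/
structure IsNetwork {N : ℕ} (a : Matrix (Fin N) (Fin N) ℝ) (b : Fin N → ℝ) : Prop where
  symm : a.IsSymm
  nonneg : ∀ i j, 0 ≤ a i j
  diag : ∀ i, a i i = 0
  leader_nonneg : ∀ i, 0 ≤ b i

/-- The graph Laplacian `L`. -/
def laplacian {N : ℕ} (a : Matrix (Fin N) (Fin N) ℝ) : Matrix (Fin N) (Fin N) ℝ :=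
  Matrix.diagonal (fun i => ∑ j, a i j) - a

/-- The smallest eigenvalue of a real symmetric matrix. -/
def lambdaMin {N : ℕ} (M : Matrix (Fin N) (Fin N) ℝ) : ℝ := sInf (spectrum ℝ M)

/-- The leader signal is `n` times continuously differentiable and its derivatives of orders
`1, …, n` are bounded by `cz` on `[0, ∞)`. -/
structure IsLeader (n : ℕ) (zr : ℝ → ℝ) (cz : ℝ) : Prop where
  contDiff : ContDiff ℝ n zr
  cz_pos : 0 < cz
  bound : ∀ l : ℕ, 1 ≤ l → l ≤ n → ∀ t : ℝ, 0 ≤ t → |iteratedDeriv l zr t| ≤ cz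

/-- The vector `(zr, zr', …, zr⁽ⁿ⁻¹⁾)` at time `t`. -/
def leaderVec (n : ℕ) (zr : ℝ → ℝ) (t : ℝ) : Fin n → ℝ := fun j => iteratedDeriv j zr t

/-! ### Intermittent communication -/

/-- Communication is ON on `[τ κ, τe κ)` and OFF on `[τe κ, τ (κ + 1))`, `κ = 0, 1, …`; the
cycles have positive length at most `T`, and they exhaust `[0, ∞)`. -/
structure IsSchedule (τ τe : ℕ → ℝ) (T : ℝ) : Prop where
  start : τ 0 = 0
  on_le : ∀ κ, τ κ ≤ τe κ
  off_le : ∀ κ, τe κ ≤ τ (κ + 1)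
  cycle_pos : ∀ κ, 0 < τ (κ + 1) - τ κ
  cycle_le : ∀ κ, τ (κ + 1) - τ κ ≤ T
  exhaust : Tendsto τ atTop atTop

/-- The `n × n` matrix `A` of a chain of `n` integrators. -/
def chainA (n : ℕ) : Matrix (Fin n) (Fin n) ℝ :=
  Matrix.of fun j k => if (k : ℕ) = (j : ℕ) + 1 then 1 else 0

/-- The column `B = (0, …, 0, 1)ᵀ`. -/
def chainB (n : ℕ) : Matrix (Fin n) (Fin 1) ℝ :=
  Matrix.of fun j _ => if (j : ℕ) + 1 = n then 1 else 0

/-- The gain row `K = c₀ Bᵀ P`. -/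
def gainK {n : ℕ} (c0 : ℕ) (P : Matrix (Fin n) (Fin n) ℝ) : Matrix (Fin 1) (Fin n) ℝ :=
  (c0 : ℝ) • ((chainB n).transpose * P)

open Classical in
/-- The intermittent distributed virtual signal `ζ_i` (the sum may run over all followers, since
`a i j = 0` for `j` that are not neighbours of `i`). -/
def virtualSignal {N n : ℕ} (a : Matrix (Fin N) (Fin N) ℝ) (b : Fin N → ℝ) (zr : ℝ → ℝ)
    (τ τe : ℕ → ℝ) (η : Fin N → ℝ → (Fin n → ℝ)) (i : Fin N) (t : ℝ) : Fin n → ℝ :=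
  if ∃ κ, t ∈ Ico (τ κ) (τe κ) then
    ∑ j, a i j • (η j t - η i t) + b i • (leaderVec n zr t - η i t)
  else 0

/-- `η` solves `η_i' = A η_i + B K ζ_i` on `[0, ∞)`. As `ζ_i` jumps at the switching instants
and is continuous from the right, the derivative is the right derivative. -/
def IsAuxiliary {N n : ℕ} (a : Matrix (Fin N) (Fin N) ℝ) (b : Fin N → ℝ) (zr : ℝ → ℝ)
    (τ τe : ℕ → ℝ) (K : Matrix (Fin 1) (Fin n) ℝ) (η : Fin N → ℝ → (Fin n → ℝ)) : Prop :=
  ∀ i, ContinuousOn (η i) (Ici 0) ∧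
    ∀ t, 0 ≤ t → HasDerivWithinAt (η i)
      ((chainA n).mulVec (η i t) +
        (chainB n * K).mulVec (virtualSignal a b zr τ τe η i t)) (Ici t) t

/-- The two matrix inequalities for the positive definite matrix `P`. -/
structure IsRiccati {n : ℕ} (P : Matrix (Fin n) (Fin n) ℝ) (c1 c3 : ℝ) : Prop where
  posDef : P.PosDef
  on_mode : (-((chainA n).transpose * P + P * chainA n
    - (2 : ℝ) • (P * chainB n * (chainB n).transpose * P) + c1 • (1 : Matrix _ _ ℝ))).PosDef
  off_mode : (-((chainA n).transpose * P + P * chainA n - c3 • P)).PosDef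

/-- The spectral norm. -/
def specNorm {n : ℕ} (P : Matrix (Fin n) (Fin n) ℝ) : ℝ := ‖Matrix.toEuclideanCLM (𝕜 := ℝ) P‖

/-- The decay rate `δ_α` of the ON mode. -/
def deltaOn (N : ℕ) {n : ℕ} (P : Matrix (Fin n) (Fin n) ℝ) (cz c1 c2 : ℝ) : ℝ :=
  (c1 - cz * N * specNorm P / c2) / specNorm P

/-- The growth rate `δ_β` of the OFF mode. -/
def deltaOff (N : ℕ) (cz c2 c3 : ℝ) : ℝ := c3 + cz * N / c2

/-! ### Agents, neural networks and control laws -/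

/-- The nonlinearities of one strict-feedback agent of order `n` with `m`-dimensional noise.
The index `q : Fin n` counts from `0`, so `f q` and `g q` are functions of `q + 1` states. -/
structure Agent (n m : ℕ) where
  f : (q : Fin n) → (Fin ((q : ℕ) + 1) → ℝ) → ℝ
  g : (q : Fin n) → (Fin ((q : ℕ) + 1) → ℝ) → EuclideanSpace ℝ (Fin m)
  f_smooth : ∀ q, ContDiff ℝ (⊤ : ℕ∞) (f q)
  g_differentiable : ∀ q, Differentiable ℝ (g q)
  g_locallyLipschitz : ∀ q, LocallyLipschitz (g q)

/-- The tuple of weight vectors of `n` networks with `L q` neurons each. -/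
abbrev Weights {n : ℕ} (L : Fin n → ℕ) : Type := (q : Fin n) → EuclideanSpace ℝ (Fin (L q))

/-- The state of one closed-loop agent: the plant state `x` and the adaptive weights `θ̂`. -/
abbrev State {n : ℕ} (L : Fin n → ℕ) : Type := (Fin n → ℝ) × Weights L

/-- The design data of one agent: gains `𝒦_q`, Young parameters `ρ_q`, adaptation gains `γ_q`,
`σ`-modification parameters `σ_q`, and for each `q` a Gaussian network with `L q` neurons whose
input vector is computed from the local signals `x_i`, `θ̂_i`, `η_i`. -/
structure Design (n : ℕ) where
  gain : Fin n → ℝ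
  rho : Fin n → ℝ
  gamma : Fin n → ℝ
  sigma : Fin n → ℝ
  gain_pos : ∀ q, 0 < gain q
  rho_pos : ∀ q, 0 < rho q
  gamma_pos : ∀ q, 0 < gamma q
  sigma_pos : ∀ q, 0 < sigma q
  L : Fin n → ℕ
  dim : Fin n → ℕ
  input : (q : Fin n) → State L × (Fin n → ℝ) → EuclideanSpace ℝ (Fin (dim q))
  input_contDiff : ∀ q, ContDiff ℝ 1 (input q)
  center : (q : Fin n) → Fin (L q) → EuclideanSpace ℝ (Fin (dim q))
  width : (q : Fin n) → Fin (L q) → ℝ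
  width_pos : ∀ q k, 0 < width q k

section Laws

variable {n m : ℕ} (ag : Agent n m) (D : Design n)

/-- The vector `φ_q` of Gaussian basis functions, at the local signals. -/
def phi (q : Fin n) (s : State D.L) (η : Fin n → ℝ) : EuclideanSpace ℝ (Fin (D.L q)) :=
  WithLp.toLp 2 fun k => Real.exp (-(‖D.input q (s, η) - D.center q k‖ ^ 2 / D.width q k ^ 2))

/-- The first `q + 1` components of the plant state. -/
def partialState (x : Fin n → ℝ) (q : Fin n) : Fin ((q : ℕ) + 1) → ℝ :=
  fun j => x (Fin.castLE q.isLt j)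

/-- The control law: `-(𝒦_q + ρ_q² ‖g_q‖² / 2) e - θ̂_qᵀ φ_q`, for a given value `e` of the
`q`-th error. -/
def controlLaw (s : State D.L) (η : Fin n → ℝ) (q : Fin n) (e : ℝ) : ℝ :=
  -(D.gain q + D.rho q ^ 2 / 2 * ‖ag.g q (partialState s.1 q)‖ ^ 2) * e
    - inner ℝ (s.2 q) (phi D q s η)

/-- The errors `e_1 = x_1 - η_1` and `e_q = x_q - α_{q-1}`. -/
def err (s : State D.L) (η : Fin n → ℝ) : (q : ℕ) → q < n → ℝ
  | 0, h => s.1 ⟨0, h⟩ - η ⟨0, h⟩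
  | q + 1, h => s.1 ⟨q + 1, h⟩ -
      controlLaw ag D s η ⟨q, Nat.lt_of_succ_lt h⟩ (err s η q (Nat.lt_of_succ_lt h))

/-- The virtual inputs `α_q`; the last one is the actual control input `u`. -/
def alpha (s : State D.L) (η : Fin n → ℝ) (q : Fin n) : ℝ :=
  controlLaw ag D s η q (err ag D s η q q.isLt)

/-- The closed-loop vector field of `(x, θ̂)`: the strict-feedback dynamics with the actual input
`u = α_n`, and the adaptive rules `θ̂_q' = γ_q (e_q φ_q - σ_q θ̂_q)`. -/
def closedLoop (s : State D.L) (η : Fin n → ℝ) (ξ : EuclideanSpace ℝ (Fin m)) : State D.L :=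
  (fun q =>
    (if h : (q : ℕ) + 1 < n then s.1 ⟨(q : ℕ) + 1, h⟩ else alpha ag D s η q)
      + ag.f q (partialState s.1 q) + inner ℝ (ag.g q (partialState s.1 q)) ξ,
   fun q => D.gamma q • (err ag D s η q q.isLt • phi D q s η - D.sigma q • s.2 q))

/-- `X` solves the closed loop on the time set `I`, for the auxiliary trajectory `η` and the
noise path `ξ`. -/
def IsSolution (η : ℝ → (Fin n → ℝ)) (ξ : ℝ → EuclideanSpace ℝ (Fin m)) (I : Set ℝ)
    (X : ℝ → State D.L) : Prop :=
  ∀ t ∈ I, HasDerivWithinAt X (closedLoop ag D (X t) (η t) (ξ t)) I t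

/-- The functions `f̄_q` that the networks have to approximate, along a trajectory `X`:
`f̄_1 = f_1 - η_2` and `f̄_q = f_q - α_{q-1}'`. The derivative is the right derivative, because
`η` has only a right derivative at the switching instants. -/
def fbar (hn : 2 ≤ n) (η : ℝ → (Fin n → ℝ)) (X : ℝ → State D.L) (t : ℝ) (q : Fin n) : ℝ :=
  ag.f q (partialState (X t).1 q) -
    if (q : ℕ) = 0 then η t ⟨1, hn⟩
    else derivWithin
      (fun s => alpha ag D (X s) (η s) ⟨(q : ℕ) - 1, lt_of_le_of_lt (Nat.sub_le _ _) q.isLt⟩)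
      (Ici t) t

/-- Neural approximation: with the constant ideal weights `θ_q` the approximation errors
`ε_q = f̄_q - θ_qᵀ φ_q` satisfy `|ε_q|² ≤ εs q` along every closed-loop trajectory, however long
it exists, that starts in `S` and is driven by one of the noise paths `ξ · ω`. -/
def IsApproximation {Ω : Type*} (hn : 2 ≤ n) (η : ℝ → (Fin n → ℝ))
    (ξ : ℝ → Ω → EuclideanSpace ℝ (Fin m)) (S : Set (State D.L)) (θ : Weights D.L)
    (εs : Fin n → ℝ) : Prop :=
  ∀ ω : Ω, ∀ b : ℝ, 0 < b → ∀ X : ℝ → State D.L,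
    IsSolution ag D η (fun t => ξ t ω) (Ico 0 b) X → X 0 ∈ S →
    ∀ t ∈ Ico 0 b, ∀ q,
      |fbar ag D hn η X t q - inner ℝ (θ q) (phi D q (X t) (η t))| ^ 2 ≤ εs q

/-- The vector of all errors `(e_1, …, e_n, θ̃_1, …, θ̃_n)`, `θ̃_q = θ_q - θ̂_q`, with the
Euclidean norm. -/
def errVec (θ : Weights D.L) (s : State D.L) (η : Fin n → ℝ) :
    WithLp 2 (EuclideanSpace ℝ (Fin n) × PiLp 2 fun q => EuclideanSpace ℝ (Fin (D.L q))) :=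
  WithLp.toLp 2
    (WithLp.toLp 2 fun q => err ag D s η q q.isLt, WithLp.toLp 2 fun q => θ q - s.2 q)

end Laws

/-! ### Noise and stability in probability -/

/-- A continuous, adapted, zero-mean process on `[0, ∞)` with second moment at most `ξs`. -/
structure IsColoredNoise {Ω : Type*} {mΩ : MeasurableSpace Ω} (Pr : Measure Ω)
    (ℱ : Filtration ℝ mΩ) {m : ℕ} (ξ : ℝ → Ω → EuclideanSpace ℝ (Fin m)) (ξs : ℝ) : Prop where
  continuous : ∀ ω, ContinuousOn (fun t => ξ t ω) (Ici 0)
  adapted : ∀ t, 0 ≤ t → Measurable[ℱ t] (ξ t)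
  zero_mean : ∀ t, 0 ≤ t → ∫ ω, ξ t ω ∂Pr = 0
  bound_pos : 0 < ξs
  moment : ∀ t, 0 ≤ t → ∫⁻ ω, ‖ξ t ω‖ₑ ^ 2 ∂Pr ≤ ENNReal.ofReal ξs

/-- Class `𝒦` functions on `[0, ∞)`. -/
structure IsClassK (d : ℝ → ℝ) : Prop where
  continuous : ContinuousOn d (Ici 0)
  strictMono : StrictMonoOn d (Ici 0)
  zero : d 0 = 0

/-- Class `𝒦ℒ` functions on `[0, ∞) × [0, ∞)`. -/
structure IsClassKL (r : ℝ → ℝ → ℝ) : Prop where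
  classK : ∀ t, 0 ≤ t → IsClassK fun s => r s t
  antitone : ∀ s, 0 ≤ s → AntitoneOn (r s) (Ici 0)
  tendsto_zero : ∀ s, 0 ≤ s → Tendsto (r s) atTop (𝓝 0)

/-- Noise-to-state practical stability in probability of a family of processes `Y s`, one for
each initial condition `s ∈ S`, under noise with second moment bound `ξs`. -/
def NSpSP {Ω ι E : Type*} [MeasurableSpace Ω] [NormedAddCommGroup E] (Pr : Measure Ω) (ξs : ℝ)
    (S : Set ι) (Y : ι → ℝ → Ω → E) : Prop :=
  ∃ la lb : ℝ, 0 < la ∧ 0 ≤ lb ∧ ∀ l0 : ℝ, 0 < l0 →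
    ∃ (r : ℝ → ℝ → ℝ) (d : ℝ → ℝ), IsClassKL r ∧ IsClassK d ∧
      ∀ s ∈ S, ∀ t : ℝ, 0 ≤ t →
        ENNReal.ofReal (1 - l0) ≤
          Pr {ω | ‖Y s t ω‖ ≤ r ‖Y s 0 ω‖ t + d (la * ξs + lb)}

end IntermittentMAS

end

namespace IntermittentMAS

/-! ### Ordinary differential equations with a locally Lipschitz right-hand side -/

section Deterministic

open scoped NNReal Nat

/-! The noise has continuous paths, so for each fixed `ω` the closed loop is an ordinary
differential equation and no stochastic calculus is needed. Probability enters only at the end,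
through Tonelli's theorem and Markov's inequality.

Backstepping. With `f̄_q` collecting `f_q` and the derivative of the previous virtual input, the
errors satisfy `e_q' = e_{q+1} - (𝒦_q + ρ_q²‖g_q‖²/2) e_q - θ̂_qᵀφ_q + g_qᵀξ + f̄_q`. The `ρ_q` term
dominates the noise, the adaptive law cancels the weight error, and the `σ`-modification makes it
decay. The couplings `e_q e_{q+1}` are absorbed without any condition on the gains by weighting the
`q`-th subsystem with `β ^ q` (`sum_pow_mul_next_sq_le`). The result is `V' ≤ -c V + C₁‖ξ‖² + C₂`
(`exists_lyapunov_deriv_le`), hence a bound of `V` by a decaying term, the exponentially weighted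
noise energy and a constant (`exists_lyapunov_le`).

Well-posedness. The closed loop is locally Lipschitz, and the approximation hypothesis covers every
local trajectory, so the same estimate excludes blow-up without presupposing global existence.
Adaptedness follows since the solution is a limit of Picard iterates of clipped equations
(`exists_adapted_solution`).

Probability. The weighted noise energy has mean at most `ξ*/c`. Markov's inequality then gives
stability in probability (`nSpSP_of_sq_le`), and `|e| ≤ 1 + e²` gives boundedness in mean
(`limsup_lintegral_lt_of_sq_le`).

Leader. For `x_i = η_i - z̄_r` the function `∑ x_iᵀ P x_i` has a rate bound in each mode. The
duty-cycle condition makes the total exponent over a cycle negative, so `η_i` stays within bounded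
distance of the leader (`exists_bound_auxiliary_sub_leaderVec`), and `|z_i - z_r| ≤ |e_{i,1}| +
|η_{i,1} - z_r|`. -/

lemma exists_lipschitzOnWith_and_bound {E U : Type*} [NormedAddCommGroup E] [ProperSpace E]
    [PseudoMetricSpace U] {H : E × U → E} (hH : LocallyLipschitz H)
    {w : ℝ → U} {T : ℝ} (hw : ContinuousOn w (Icc 0 T)) (R : ℝ) :
    ∃ K L : ℝ≥0, ∀ t ∈ Icc 0 T,
      LipschitzOnWith K (fun x => H (x, w t)) (Metric.closedBall 0 R) ∧
        ∀ x ∈ Metric.closedBall 0 R, ‖H (x, w t)‖ ≤ L := by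
  have hc : IsCompact (Metric.closedBall (0 : E) R ×ˢ (w '' Icc 0 T)) :=
    (isCompact_closedBall 0 R).prod (isCompact_Icc.image_of_continuousOn hw)
  obtain ⟨K, hK⟩ := hH.locallyLipschitzOn.exists_lipschitzOnWith_of_compact hc
  obtain ⟨L, hL⟩ := hc.exists_bound_of_continuousOn hH.continuous.continuousOn
  refine ⟨K, L.toNNReal, fun t ht => ⟨fun x hx y hy => ?_, fun x hx => ?_⟩⟩
  · refine (hK (x := (x, w t)) ⟨hx, mem_image_of_mem w ht⟩
      (y := (y, w t)) ⟨hy, mem_image_of_mem w ht⟩).trans_eq ?_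
    simp [Prod.edist_eq]
  · exact (hL (x, w t) ⟨hx, mem_image_of_mem w ht⟩).trans (Real.le_coe_toNNReal L)

variable {E : Type*} [NormedAddCommGroup E] [NormedSpace ℝ E]

/-- The radial retraction onto the closed ball of radius `R`. -/
noncomputable def radialClip (R : ℝ) (x : E) : E := (R / max R ‖x‖) • x

lemma norm_radialClip_le {R : ℝ} (hR : 0 < R) (x : E) : ‖radialClip R x‖ ≤ R := by
  have hm : 0 < max R ‖x‖ := lt_max_of_lt_left hR
  rw [radialClip, norm_smul, Real.norm_of_nonneg (by positivity), div_mul_eq_mul_div,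
    div_le_iff₀ hm]
  gcongr
  exact le_max_right _ _

lemma radialClip_of_norm_le {R : ℝ} (hR : 0 < R) {x : E} (hx : ‖x‖ ≤ R) : radialClip R x = x := by
  rw [radialClip, max_eq_left hx, div_self hR.ne', one_smul]

/-- In a general normed space the constant is 2: the difference splits into a scaled `x - y` and a
change of scaling factor applied to `y`, and each part is at most `‖x - y‖`. -/
lemma lipschitzWith_radialClip {R : ℝ} (hR : 0 < R) :
    LipschitzWith 2 (radialClip R : E → E) := by
  refine LipschitzWith.of_dist_le_mul fun x y => ?_
  rw [dist_eq_norm, dist_eq_norm]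
  have ha : 0 < max R ‖x‖ := lt_max_of_lt_left hR
  have hb : 0 < max R ‖y‖ := lt_max_of_lt_left hR
  have hab : |max R ‖y‖ - max R ‖x‖| ≤ ‖x - y‖ := by
    rw [max_comm R, max_comm R]
    refine (abs_max_sub_max_le_abs _ _ _).trans ?_
    rw [abs_sub_comm]
    exact abs_norm_sub_norm_le x y
  have hRa : R ≤ max R ‖x‖ := le_max_left _ _
  have hyb : ‖y‖ ≤ max R ‖y‖ := le_max_right _ _
  simp only [radialClip]
  generalize max R ‖x‖ = a at *
  generalize max R ‖y‖ = b at *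
  have h1 : (R / a) • x - (R / b) • y = (R / a) • (x - y) + (R / a - R / b) • y := by
    rw [smul_sub, sub_smul]; abel
  have h2 : |R / a - R / b| * ‖y‖ = (R / a) * (‖y‖ / b) * |b - a| := by
    have : R / a - R / b = R / (a * b) * (b - a) := by field_simp
    rw [this, abs_mul, abs_of_pos (by positivity)]
    field_simp
  have h3 : R / a ≤ 1 := (div_le_one ha).2 hRa
  have h4 : ‖y‖ / b ≤ 1 := (div_le_one hb).2 hyb
  have h5 : 0 ≤ R / a := by positivity
  have h6 : 0 ≤ ‖y‖ / b := by positivity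
  rw [h1]
  calc ‖(R / a) • (x - y) + (R / a - R / b) • y‖
      ≤ ‖(R / a) • (x - y)‖ + ‖(R / a - R / b) • y‖ := norm_add_le _ _
    _ = R / a * ‖x - y‖ + (R / a) * (‖y‖ / b) * |b - a| := by
        rw [norm_smul, norm_smul, Real.norm_eq_abs, Real.norm_eq_abs, h2, abs_of_nonneg h5]
    _ ≤ 1 * ‖x - y‖ + 1 * 1 * ‖x - y‖ := by gcongr
    _ = ((2 : ℝ≥0) : ℝ) * ‖x - y‖ := by push_cast; ring

lemma lipschitzWith_comp_radialClip {U : Type*} {H : E × U → E} {w : U} {R : ℝ} (hR : 0 < R)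
    {K : ℝ≥0}
    (hK : LipschitzOnWith K (fun x => H (x, w)) (Metric.closedBall 0 R)) :
    LipschitzWith (K * 2) (fun x => H (radialClip R x, w)) := by
  rw [← lipschitzOnWith_univ]
  exact hK.comp (lipschitzWith_radialClip hR).lipschitzOnWith
    fun x _ => mem_closedBall_zero_iff.2 (norm_radialClip_le hR x)

variable {U : Type*} [PseudoMetricSpace U]

/-- On `[0, t]` with `t < c` both solutions are bounded, so they stay in one ball on which the field
is Lipschitz uniformly in time, and Grönwall applies. -/
lemma eqOn_of_hasDerivWithinAt [ProperSpace E] {H : E × U → E} (hH : LocallyLipschitz H)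
    {w : ℝ → U} {c : ℝ} (hw : ContinuousOn w (Ici 0)) {X Y : ℝ → E}
    (hX : ∀ t ∈ Ico 0 c, HasDerivWithinAt X (H (X t, w t)) (Ico 0 c) t)
    (hY : ∀ t ∈ Ico 0 c, HasDerivWithinAt Y (H (Y t, w t)) (Ico 0 c) t) (h0 : X 0 = Y 0) :
    EqOn X Y (Ico 0 c) := by
  intro t ht
  have hsub : Icc 0 t ⊆ Ico 0 c := fun r hr => ⟨hr.1, hr.2.trans_lt ht.2⟩
  have hright : ∀ {Z : ℝ → E}, (∀ t ∈ Ico 0 c, HasDerivWithinAt Z (H (Z t, w t)) (Ico 0 c) t) →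
      ∀ r ∈ Ico 0 t, HasDerivWithinAt Z (H (Z r, w r)) (Ici r) r := fun hZ r hr =>
    (hZ r (hsub (Ico_subset_Icc_self hr))).mono_of_mem_nhdsWithin <|
      mem_of_superset (Ico_mem_nhdsGE (hr.2.trans ht.2)) (Ico_subset_Ico_left hr.1)
  have hcX : ContinuousOn X (Icc 0 t) := fun r hr => ((hX r (hsub hr)).continuousWithinAt).mono hsub
  have hcY : ContinuousOn Y (Icc 0 t) := fun r hr => ((hY r (hsub hr)).continuousWithinAt).mono hsub
  obtain ⟨A, hA⟩ := isCompact_Icc.exists_bound_of_continuousOn hcX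
  obtain ⟨B, hB⟩ := isCompact_Icc.exists_bound_of_continuousOn hcY
  obtain ⟨K, _, hK⟩ := exists_lipschitzOnWith_and_bound hH
    (hw.mono (Icc_subset_Ici_self : Icc 0 t ⊆ Ici 0)) (max A B)
  exact ODE_solution_unique_of_mem_Icc_right (v := fun r x => H (x, w r))
    (s := fun _ => Metric.closedBall 0 (max A B))
    (fun r hr => (hK r (Ico_subset_Icc_self hr)).1) hcX (hright hX)
    (fun r hr => mem_closedBall_zero_iff.2
      ((hA r (Ico_subset_Icc_self hr)).trans (le_max_left _ _)))
    hcY (hright hY)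
    (fun r hr => mem_closedBall_zero_iff.2
      ((hB r (Ico_subset_Icc_self hr)).trans (le_max_right _ _))) h0 ⟨ht.1, le_rfl⟩

/-- Clipping makes the field bounded and globally Lipschitz, so Picard–Lindelöf reaches the end of
`[0, T]` in a single step. -/
lemma exists_clipped_solution [ProperSpace E] {H : E × U → E} (hH : LocallyLipschitz H)
    {w : ℝ → U} {T : ℝ} (hT : 0 ≤ T) (hw : ContinuousOn w (Icc 0 T)) {R : ℝ} (hR : 0 < R) (s : E) :
    ∃ X : ℝ → E, X 0 = s ∧ ∀ t ∈ Icc 0 T,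
      HasDerivWithinAt X (H (radialClip R (X t), w t)) (Icc 0 T) t := by
  obtain ⟨K, L, hKL⟩ := exists_lipschitzOnWith_and_bound hH hw R
  have hpl : IsPicardLindelof (fun t x => H (radialClip R x, w t))
      -- The radius is the bound of the field times the length of the interval, so no solution can
      -- leave the ball.
      (⟨0, le_rfl, hT⟩ : Icc 0 T) s (L * T.toNNReal) 0 L (K * 2) := by
    refine ⟨fun t ht => ?_, fun x _ => ?_, fun t ht x _ => ?_, ?_⟩
    · exact (lipschitzWith_comp_radialClip hR (hKL t ht).1).lipschitzOnWith
    · exact hH.continuous.comp_continuousOn (continuousOn_const.prodMk hw)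
    · exact (hKL t ht).2 _ (mem_closedBall_zero_iff.2 (norm_radialClip_le hR x))
    · simp [hT]
  exact hpl.exists_eq_forall_mem_Icc_hasDerivWithinAt₀

/-- Clip beyond the a priori bound `M`. Until it first reaches the clipping radius, the clipped
solution solves the original equation, so its norm is at most `M`. By continuity this still holds at
the first hitting time, a contradiction. -/
lemma exists_solution_Icc [ProperSpace E] {H : E × U → E} (hH : LocallyLipschitz H)
    {w : ℝ → U} {T : ℝ} (hT : 0 < T) (hw : ContinuousOn w (Icc 0 T)) (s : E)
    (hbound : ∃ M : ℝ, ∀ b ∈ Ioc 0 T, ∀ X : ℝ → E,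
      (∀ t ∈ Ico 0 b, HasDerivWithinAt X (H (X t, w t)) (Ico 0 b) t) → X 0 = s →
        ∀ t ∈ Ico 0 b, ‖X t‖ ≤ M) :
    ∃ X : ℝ → E, X 0 = s ∧ ∀ t ∈ Icc 0 T, HasDerivWithinAt X (H (X t, w t)) (Icc 0 T) t := by
  obtain ⟨M, hM⟩ := hbound
  have hR : 0 < max M ‖s‖ + 1 := by positivity
  obtain ⟨X, hX0, hX⟩ := exists_clipped_solution hH hT.le hw hR s
  set R := max M ‖s‖ + 1
  have hcont : ContinuousOn X (Icc 0 T) := fun t ht => (hX t ht).continuousWithinAt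
  have hsol : ∀ b ∈ Ioc 0 T, (∀ t ∈ Ico 0 b, ‖X t‖ ≤ R) → ∀ t ∈ Ico 0 b,
      HasDerivWithinAt X (H (X t, w t)) (Ico 0 b) t := fun b hb hlt t ht => by
    have h := (hX t ⟨ht.1, ht.2.le.trans hb.2⟩).mono
      (show Ico 0 b ⊆ Icc 0 T from fun r hr => ⟨hr.1, hr.2.le.trans hb.2⟩)
    rwa [radialClip_of_norm_le hR (hlt t ht)] at h
  have hlt : ∀ t ∈ Icc 0 T, ‖X t‖ < R := by
    by_contra! hcon
    have hcomp : IsCompact (Icc 0 T ∩ (fun t => ‖X t‖) ⁻¹' Ici R) :=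
      isCompact_Icc.of_isClosed_subset
        (hcont.norm.preimage_isClosed_of_isClosed isClosed_Icc isClosed_Ici) inter_subset_left
    obtain ⟨b, ⟨hb, hbR⟩, hmin⟩ := hcomp.exists_isLeast
      (let ⟨t, ht, h⟩ := hcon; ⟨t, ht, h⟩)
    have hb0 : 0 < b := by
      rcases hb.1.eq_or_lt with h | h
      · have hle : R ≤ ‖s‖ := by simpa [← h, hX0] using hbR
        linarith [le_max_right M ‖s‖]
      · exact h
    have hbelow : ∀ t ∈ Ico 0 b, ‖X t‖ ≤ R := fun t ht => by
      by_contra! h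
      exact (hmin ⟨⟨ht.1, ht.2.le.trans hb.2⟩, h.le⟩).not_gt ht.2
    have hMb := hM b ⟨hb0, hb.2⟩ X (hsol b ⟨hb0, hb.2⟩ hbelow) hX0
    have hlim : Tendsto (fun t => ‖X t‖) (𝓝[Ico 0 b] b) (𝓝 ‖X b‖) :=
      ((hcont b hb).mono (fun r hr => ⟨hr.1, hr.2.le.trans hb.2⟩)).norm
    have : (𝓝[Ico 0 b] b).NeBot := by
      rw [← mem_closure_iff_nhdsWithin_neBot, closure_Ico hb0.ne]
      exact ⟨hb.1, le_rfl⟩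
    have : ‖X b‖ ≤ M := le_of_tendsto hlim (eventually_mem_nhdsWithin.mono hMb)
    have hbR' : R ≤ ‖X b‖ := hbR
    linarith [le_max_left M ‖s‖]
  refine ⟨X, hX0, fun t ht => ?_⟩
  have h := hX t ht
  rwa [radialClip_of_norm_le hR (hlt t ht).le] at h

lemma exists_solution_Ici [ProperSpace E] {H : E × U → E} (hH : LocallyLipschitz H)
    {w : ℝ → U} (hw : ContinuousOn w (Ici 0)) (s : E)
    (hbound : ∀ T, 0 < T → ∃ M : ℝ, ∀ b ∈ Ioc 0 T, ∀ X : ℝ → E,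
      (∀ t ∈ Ico 0 b, HasDerivWithinAt X (H (X t, w t)) (Ico 0 b) t) → X 0 = s →
        ∀ t ∈ Ico 0 b, ‖X t‖ ≤ M) :
    ∃ X : ℝ → E, X 0 = s ∧ ∀ t ∈ Ici 0, HasDerivWithinAt X (H (X t, w t)) (Ici 0) t := by
  have hex : ∀ k : ℕ, ∃ X : ℝ → E, X 0 = s ∧ ∀ t ∈ Icc (0 : ℝ) (k + 1),
      HasDerivWithinAt X (H (X t, w t)) (Icc (0 : ℝ) (k + 1)) t := fun k =>
    exists_solution_Icc hH (by positivity) (hw.mono Icc_subset_Ici_self) s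
      (hbound _ (by positivity))
  choose Z hZ0 hZ using hex
  have hIco : ∀ (k : ℕ) (c : ℝ), c ≤ k + 1 → ∀ t ∈ Ico 0 c,
      HasDerivWithinAt (Z k) (H (Z k t, w t)) (Ico 0 c) t := fun k c hc t ht =>
    (hZ k t ⟨ht.1, ht.2.le.trans hc⟩).mono (fun r hr => ⟨hr.1, hr.2.le.trans hc⟩)
  have heq : ∀ k l : ℕ, ∀ t : ℝ, 0 ≤ t → t < k + 1 → t < l + 1 → Z k t = Z l t := by
    intro k l t ht hk hl
    exact eqOn_of_hasDerivWithinAt hH hw (hIco k _ (min_le_left _ _))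
      (hIco l _ (min_le_right _ _)) ((hZ0 k).trans (hZ0 l).symm) ⟨ht, lt_min hk hl⟩
  -- Solution number `⌊t⌋` lives up to time `⌊t⌋ + 1 > t`. Near a given `t` the glued function
  -- agrees with the single solution number `⌊t⌋ + 1`, from which it inherits the derivative.
  refine ⟨fun t => Z ⌊t⌋₊ t, by simp [hZ0], fun t ht => ?_⟩
  set k := ⌊t⌋₊ + 1
  have htk : t < k := by simpa [k] using Nat.lt_floor_add_one t
  have heqk : ∀ r ∈ Ico (0 : ℝ) k, Z ⌊r⌋₊ r = Z k r := fun r hr =>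
    heq _ _ r hr.1 (Nat.lt_floor_add_one r) (by linarith [hr.2])
  have hd := hIco k k (by linarith) t ⟨ht, htk⟩
  have hd' : HasDerivWithinAt (fun t => Z ⌊t⌋₊ t) (H (Z k t, w t)) (Ico 0 k) t :=
    hd.congr heqk (heqk t ⟨ht, htk⟩)
  rw [← heqk t ⟨ht, htk⟩] at hd'
  refine hd'.mono_of_mem_nhdsWithin ?_
  filter_upwards [self_mem_nhdsWithin, nhdsWithin_le_nhds (Iio_mem_nhds htk)] with r h1 h2
  exact ⟨h1, h2⟩

/-- The Picard iterates of `x' = v t x`, `x 0 = s`, from the constant function `s`. -/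
noncomputable def picardIterate (v : ℝ → E → E) (s : E) : ℕ → ℝ → E
  | 0 => fun _ => s
  | k + 1 => ODE.picard v 0 s (picardIterate v s k)

lemma continuous_picardIterate [CompleteSpace E] {v : ℝ → E → E}
    (hv : Continuous (Function.uncurry v)) (s : E) (k : ℕ) : Continuous (picardIterate v s k) := by
  induction k with
  | zero => exact continuous_const
  | succ k ih =>
    have hc : Continuous fun r => v r (picardIterate v s k r) :=
      hv.comp (continuous_id.prodMk ih)
    exact continuous_const.add (intervalIntegral.continuous_primitive
      (fun a b => hc.intervalIntegrable a b) 0)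

/-- The iterates are compared with a given solution: each integration gains a factor `K t / (k +
1)`. The factorial gives convergence on all of `[0, T]` with no smallness of `T`, which is what
transfers measurability to the solution. -/
lemma norm_picardIterate_sub_le [CompleteSpace E] {v : ℝ → E → E}
    (hv : Continuous (Function.uncurry v)) {T : ℝ} {K : ℝ≥0}
    (hK : ∀ t ∈ Icc 0 T, LipschitzWith K (v t)) {s : E} {X : ℝ → E} (hX0 : X 0 = s)
    (hX : ∀ t ∈ Icc 0 T, HasDerivWithinAt X (v t (X t)) (Icc 0 T) t) {M : ℝ}
    (hM : ∀ t ∈ Icc 0 T, ‖s - X t‖ ≤ M) (k : ℕ) :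
    ∀ t ∈ Icc 0 T, ‖picardIterate v s k t - X t‖ ≤ M * ((K * t) ^ k / k !) := by
  induction k with
  | zero => simpa [picardIterate] using hM
  | succ k ih =>
    intro t ht
    have hsub : uIcc 0 t ⊆ Icc 0 T := by
      rw [uIcc_of_le ht.1]; exact Icc_subset_Icc_right ht.2
    have hcX : ContinuousOn X (uIcc 0 t) := fun r hr =>
      ((hX r (hsub hr)).continuousWithinAt).mono hsub
    have hXeq : X t = s + ∫ r in 0..t, v r (X r) := by
      have := ODE.picard_eq_of_hasDerivAt (t₀ := 0) (t := t) (u := univ) (f := v) (α := X)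
        hv.continuousOn (fun r hr => (hX r (hsub hr)).mono hsub) (mapsTo_univ _ _)
      rw [← this, ODE.picard_apply, hX0]
    have hi1 : IntervalIntegrable (fun r => v r (picardIterate v s k r)) volume 0 t :=
      (hv.comp (continuous_id.prodMk (continuous_picardIterate hv s k))).intervalIntegrable 0 t
    have hi2 : IntervalIntegrable (fun r => v r (X r)) volume 0 t :=
      (hv.comp_continuousOn (continuousOn_id.prodMk hcX)).intervalIntegrable
    have hsplit : picardIterate v s (k + 1) t - X t
        = ∫ r in 0..t, (v r (picardIterate v s k r) - v r (X r)) := by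
      rw [intervalIntegral.integral_sub hi1 hi2, hXeq, picardIterate, ODE.picard_apply]
      abel
    rw [hsplit]
    have hle : ‖∫ r in 0..t, (v r (picardIterate v s k r) - v r (X r))‖
        ≤ ∫ r in 0..t, (M * K ^ (k + 1) / k !) * r ^ k := by
      refine intervalIntegral.norm_integral_le_of_norm_le ht.1 ?_
        ((by fun_prop : Continuous fun r : ℝ => (M * K ^ (k + 1) / k !) * r ^ k).intervalIntegrable _ _)
      refine Eventually.of_forall fun r hr => ?_
      have hrT : r ∈ Icc 0 T := ⟨hr.1.le, hr.2.trans ht.2⟩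
      calc ‖v r (picardIterate v s k r) - v r (X r)‖
          ≤ K * ‖picardIterate v s k r - X r‖ := (hK r hrT).norm_sub_le _ _
        _ ≤ K * (M * ((K * r) ^ k / k !)) := by gcongr; exact ih r hrT
        _ = (M * K ^ (k + 1) / k !) * r ^ k := by rw [mul_pow]; ring
    refine hle.trans_eq ?_
    rw [intervalIntegral.integral_const_mul, integral_pow, Nat.factorial_succ]
    push_cast
    field_simp
    simp only [mul_pow, ne_eq, Nat.add_eq_zero_iff, one_ne_zero, and_false, not_false_eq_true,
      zero_pow, sub_zero]
    ring

lemma tendsto_picardIterate [CompleteSpace E] {v : ℝ → E → E}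
    (hv : Continuous (Function.uncurry v)) {T : ℝ} {K : ℝ≥0}
    (hK : ∀ t ∈ Icc 0 T, LipschitzWith K (v t)) {s : E} {X : ℝ → E} (hX0 : X 0 = s)
    (hX : ∀ t ∈ Icc 0 T, HasDerivWithinAt X (v t (X t)) (Icc 0 T) t) {t : ℝ} (ht : t ∈ Icc 0 T) :
    Tendsto (fun k => picardIterate v s k t) atTop (𝓝 (X t)) := by
  have hc : ContinuousOn (fun r => s - X r) (Icc 0 T) :=
    continuousOn_const.sub fun r hr => (hX r hr).continuousWithinAt
  obtain ⟨M, hM⟩ := isCompact_Icc.exists_bound_of_continuousOn hc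
  rw [tendsto_iff_norm_sub_tendsto_zero]
  refine squeeze_zero (fun _ => norm_nonneg _)
    (fun k => norm_picardIterate_sub_le hv hK hX0 hX hM k t ht) ?_
  simpa using (FloorSemiring.tendsto_pow_div_factorial_atTop ((K : ℝ) * t)).const_mul M

end Deterministic

/-! ### Random ordinary differential equations -/

section Random

open scoped NNReal

variable {Ω E U : Type*} [NormedAddCommGroup E] [NormedSpace ℝ E]

/-- A function continuous in `r` and measurable in `ω` is jointly measurable. The σ-algebra is
arbitrary, so that it can be taken to be `ℱ T`. -/
lemma measurable_intervalIntegral_of_continuous {m : MeasurableSpace Ω} [CompleteSpace E]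
    [SecondCountableTopology E] [MeasurableSpace E] [BorelSpace E] {Φ : ℝ → Ω → E}
    (hc : ∀ ω, Continuous fun r => Φ r ω) (hm : ∀ r, Measurable (Φ r)) (t : ℝ) :
    Measurable fun ω => ∫ r in 0..t, Φ r ω := by
  have hu : StronglyMeasurable (Function.uncurry fun ω r => Φ r ω) :=
    ((measurable_uncurry_of_continuous_of_measurable hc hm).comp measurable_swap).stronglyMeasurable
  simp only [intervalIntegral]
  exact (hu.integral_prod_right.sub hu.integral_prod_right).measurable

lemma measurable_picardIterate {m : MeasurableSpace Ω} [CompleteSpace E]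
    [SecondCountableTopology E] [MeasurableSpace E] [BorelSpace E] [TopologicalSpace U]
    [SecondCountableTopology U] [MeasurableSpace U] [BorelSpace U] {H : E × U → E}
    (hH : Continuous H) {w : ℝ → Ω → U} (hc : ∀ ω, Continuous fun r => w r ω)
    (hm : ∀ r, Measurable (w r)) (s : E) (k : ℕ) (t : ℝ) :
    Measurable fun ω => picardIterate (fun r x => H (x, w r ω)) s k t := by
  have hv : ∀ ω, Continuous (Function.uncurry fun r x => H (x, w r ω)) := fun ω =>
    hH.comp (continuous_snd.prodMk ((hc ω).comp continuous_fst))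
  induction k generalizing t with
  | zero => exact measurable_const
  | succ k ih =>
    refine measurable_const.add (measurable_intervalIntegral_of_continuous
      (Φ := fun r ω => H (picardIterate (fun r x => H (x, w r ω)) s k r, w r ω)) (fun ω => ?_)
      (fun r => ?_) t)
    · exact hH.comp ((continuous_picardIterate (hv ω) s k).prodMk (hc ω))
    · exact hH.measurable.comp ((ih r).prodMk (hm r))

lemma continuous_comp_projIcc {X : Type*} [TopologicalSpace X] {f : ℝ → X} {T : ℝ} (hT : 0 ≤ T)
    (hf : ContinuousOn f (Ici 0)) : Continuous fun r => f (projIcc 0 T hT r) :=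
  (hf.mono Icc_subset_Ici_self).comp_continuous (continuous_subtype_val.comp continuous_projIcc)
    fun r => (projIcc 0 T hT r).2

/-- Two limits are taken: Picard iterates converge to the clipped solution at a fixed radius, and
the clipped solutions converge to the true one as the radius grows. -/
lemma measurable_solution [ProperSpace E] [MeasurableSpace E] [BorelSpace E]
    [PseudoMetricSpace U] [SecondCountableTopology U] [MeasurableSpace U] [BorelSpace U]
    {mΩ : MeasurableSpace Ω} (ℱ : Filtration ℝ mΩ) {H : E × U → E} (hH : LocallyLipschitz H)
    {w : ℝ → Ω → U} (hc : ∀ ω, ContinuousOn (fun t => w t ω) (Ici 0))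
    (hm : ∀ t, 0 ≤ t → Measurable[ℱ t] (w t)) (s : E) {X : ℝ → Ω → E} (hX0 : ∀ ω, X 0 ω = s)
    (hX : ∀ ω, ∀ t ∈ Ici 0,
      HasDerivWithinAt (fun t => X t ω) (H (X t ω, w t ω)) (Ici 0) t) {T : ℝ} (hT : 0 ≤ T) :
    Measurable[ℱ T] (X T) := by
  have : SecondCountableTopology E := secondCountable_of_proper
  have hR : ∀ k : ℕ, (0 : ℝ) < k + 1 := fun k => by positivity
  choose Y hY0 hY using fun (k : ℕ) (ω : Ω) => exists_clipped_solution hH hT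
    ((hc ω).mono (Icc_subset_Ici_self : Icc 0 T ⊆ Ici 0)) (hR k) s
  -- Freezing the input outside `[0, T]` makes it continuous on all of `ℝ`, with every value `ℱ
  -- T`-measurable.
  set v : Ω → ℝ → U := fun ω r => w (projIcc 0 T hT r) ω
  have hvc : ∀ ω, Continuous (v ω) := fun ω => continuous_comp_projIcc hT (hc ω)
  have hvT : ∀ ω, ∀ r ∈ Icc 0 T, v ω r = w r ω := fun ω r hr => by
    simp only [v, projIcc_of_mem hT hr]
  have hcl : ∀ k : ℕ, Continuous (radialClip (k + 1 : ℝ) : E → E) := fun k =>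
    (lipschitzWith_radialClip (hR k)).continuous
  have hHk : ∀ k : ℕ, Continuous fun p : E × U => H (radialClip (k + 1 : ℝ) p.1, p.2) := fun k =>
    hH.continuous.comp (((hcl k).comp continuous_fst).prodMk continuous_snd)
  have hconv : ∀ (k : ℕ) ω {Z : ℝ → E}, Z 0 = s →
      (∀ t ∈ Icc 0 T, HasDerivWithinAt Z (H (radialClip (k + 1 : ℝ) (Z t), w t ω)) (Icc 0 T) t) →
      Tendsto (fun l => picardIterate (fun r x => H (radialClip (k + 1 : ℝ) x, v ω r)) s l T)
        atTop (𝓝 (Z T)) := by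
    intro k ω Z hZ0 hZ
    obtain ⟨K, _, hK⟩ := exists_lipschitzOnWith_and_bound hH
      ((hc ω).mono (Icc_subset_Ici_self : Icc 0 T ⊆ Ici 0)) ((k : ℝ) + 1)
    refine tendsto_picardIterate (v := fun r x => H (radialClip (k + 1 : ℝ) x, v ω r)) (T := T)
      (K := K * 2) ((hHk k).comp (continuous_snd.prodMk ((hvc ω).comp continuous_fst))) (fun t ht => ?_) hZ0
      (fun t ht => ?_) ⟨hT, le_rfl⟩
    · simp only [hvT ω t ht]
      exact lipschitzWith_comp_radialClip (hR k) (hK t ht).1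
    · simpa only [hvT ω t ht] using hZ t ht
  have hYm : ∀ k, Measurable[ℱ T] fun ω => Y k ω T := fun k => by
    refine @measurable_of_tendsto_metrizable _ _ (ℱ T) _ _ _ _ _ _ (fun l => ?_)
      (tendsto_pi_nhds.2 fun ω => hconv k ω (hY0 k ω) (hY k ω))
    exact @measurable_picardIterate Ω E U _ _ (ℱ T) _ _ _ _ _ _ _ _ _ (hHk k)
      (fun r ω => v ω r) hvc
      (fun r => (hm _ (projIcc 0 T hT r).2.1).mono (ℱ.mono (projIcc 0 T hT r).2.2) le_rfl) s l T
  refine @measurable_of_tendsto_metrizable _ _ (ℱ T) _ _ _ _ _ _ hYm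
    (tendsto_pi_nhds.2 fun ω => ?_)
  have hcX : ContinuousOn (fun t => X t ω) (Icc 0 T) := fun t ht =>
    ((hX ω t ht.1).continuousWithinAt).mono Icc_subset_Ici_self
  obtain ⟨M, hM⟩ := isCompact_Icc.exists_bound_of_continuousOn hcX
  obtain ⟨k₀, hk₀⟩ := exists_nat_ge M
  -- For fixed `ω` the sequence is eventually constant: once the radius exceeds the bound of the
  -- path on `[0, T]`, the path solves the clipped equation too, and both solutions are limits of
  -- the same Picard iterates.
  refine tendsto_const_nhds.congr' ?_
  filter_upwards [eventually_ge_atTop k₀] with k hk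
  refine tendsto_nhds_unique (hconv k ω (Z := fun t => X t ω) (hX0 ω) fun t ht => ?_) (hconv k ω (hY0 k ω) (hY k ω))
  have hkM : ‖X t ω‖ ≤ (k : ℝ) + 1 := by
    have : (k₀ : ℝ) ≤ k := by exact_mod_cast hk
    linarith [hM t ht]
  rw [radialClip_of_norm_le (hR k) hkM]
  exact (hX ω t ht.1).mono Icc_subset_Ici_self

/-- A random differential equation with a locally Lipschitz right-hand side and continuous adapted
coefficients, all of whose local solutions are bounded on bounded intervals, has a unique global
solution, and this solution is adapted. -/
theorem exists_adapted_solution [ProperSpace E] [MeasurableSpace E] [BorelSpace E]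
    [PseudoMetricSpace U] [SecondCountableTopology U] [MeasurableSpace U] [BorelSpace U]
    {mΩ : MeasurableSpace Ω} (ℱ : Filtration ℝ mΩ) {H : E × U → E} (hH : LocallyLipschitz H)
    {w : ℝ → Ω → U} (hc : ∀ ω, ContinuousOn (fun t => w t ω) (Ici 0))
    (hm : ∀ t, 0 ≤ t → Measurable[ℱ t] (w t)) (s : E)
    (hbound : ∀ ω, ∀ T, 0 < T → ∃ M : ℝ, ∀ b ∈ Ioc 0 T, ∀ X : ℝ → E,
      (∀ t ∈ Ico 0 b, HasDerivWithinAt X (H (X t, w t ω)) (Ico 0 b) t) → X 0 = s →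
        ∀ t ∈ Ico 0 b, ‖X t‖ ≤ M) :
    ∃ X : ℝ → Ω → E, (∀ t, 0 ≤ t → Measurable[ℱ t] (X t)) ∧ ∀ ω, X 0 ω = s ∧
      (∀ t ∈ Ici 0, HasDerivWithinAt (fun t => X t ω) (H (X t ω, w t ω)) (Ici 0) t) ∧
      ∀ (c : ℝ) (Y : ℝ → E), 0 < c →
        (∀ t ∈ Ico 0 c, HasDerivWithinAt Y (H (Y t, w t ω)) (Ico 0 c) t) → Y 0 = s →
        ∀ t ∈ Ico 0 c, Y t = X t ω := by
  choose X hX0 hX using fun ω => exists_solution_Ici hH (hc ω) s (hbound ω)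
  refine ⟨fun t ω => X ω t, fun t ht => measurable_solution ℱ hH hc hm s hX0 hX ht,
    fun ω => ⟨hX0 ω, hX ω, fun c Y _ hY hY0 => ?_⟩⟩
  exact eqOn_of_hasDerivWithinAt hH (hc ω) hY
    (fun t ht => (hX ω t ht.1).mono Ico_subset_Ici_self) (hY0.trans (hX0 ω).symm)

end Random

/-! ### Comparison -/

section Comparison

lemma continuous_comp_max_zero {X : Type*} [TopologicalSpace X] {f : ℝ → X}
    (hf : ContinuousOn f (Ici 0)) : Continuous fun t => f (max t 0) :=
  hf.comp_continuous (by fun_prop) fun t => le_max_right t 0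

/-- The function `exp (c t) V` has right derivative at most `exp (c t) k`. Only right derivatives
are assumed, because `η` has a corner at the switching instants. -/
lemma le_exp_mul_add_integral {V V' k : ℝ → ℝ} {c b : ℝ} (hk : Continuous k)
    (hVc : ContinuousOn V (Ico 0 b))
    (hV : ∀ t ∈ Ico 0 b, HasDerivWithinAt V (V' t) (Ici t) t)
    (hle : ∀ t ∈ Ico 0 b, V' t ≤ -c * V t + k t) {t : ℝ} (ht : t ∈ Ico 0 b) :
    V t ≤ Real.exp (-c * t) * V 0 + ∫ r in 0..t, Real.exp (-c * (t - r)) * k r := by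
  have hsub : Icc 0 t ⊆ Ico 0 b := fun r hr => ⟨hr.1, hr.2.trans_lt ht.2⟩
  have hex : ∀ r : ℝ, HasDerivAt (fun r => Real.exp (c * r)) (Real.exp (c * r) * c) r := fun r => by
    simpa using ((hasDerivAt_id r).const_mul c).exp
  have hki : Continuous fun r => Real.exp (c * r) * k r := by fun_prop
  have hB : ∀ r : ℝ, HasDerivAt (fun r => V 0 + ∫ u in 0..r, Real.exp (c * u) * k u)
      (Real.exp (c * r) * k r) r := fun r =>
    (intervalIntegral.integral_hasDerivAt_right (hki.intervalIntegrable _ _)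
      (hki.stronglyMeasurableAtFilter _ _) hki.continuousAt).const_add (V 0)
  have key := image_le_of_deriv_right_le_deriv_boundary (a := 0) (b := t)
    (f := fun r => Real.exp (c * r) * V r)
    (f' := fun r => Real.exp (c * r) * c * V r + Real.exp (c * r) * V' r)
    (B := fun r => V 0 + ∫ u in 0..r, Real.exp (c * u) * k u)
    (B' := fun r => Real.exp (c * r) * k r)
    ((by fun_prop : Continuous fun r => Real.exp (c * r)).continuousOn.mul (hVc.mono hsub))
    (fun r hr => (hex r).hasDerivWithinAt.mul (hV r (hsub (Ico_subset_Icc_self hr))))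
    (by simp) (fun r _ => (hB r).continuousAt.continuousWithinAt)
    (fun r _ => (hB r).hasDerivWithinAt)
    (fun r hr => by
      have := mul_le_mul_of_nonneg_left (hle r (hsub (Ico_subset_Icc_self hr)))
        (Real.exp_pos (c * r)).le
      linarith) ⟨ht.1, le_rfl⟩
  have h2 := mul_le_mul_of_nonneg_left key (Real.exp_pos (-c * t)).le
  have h3 : Real.exp (-c * t) * (Real.exp (c * t) * V t) = V t := by
    rw [← mul_assoc, ← Real.exp_add]; simp
  have h4 : ∫ r in 0..t, Real.exp (-c * (t - r)) * k r
      = Real.exp (-c * t) * ∫ r in 0..t, Real.exp (c * r) * k r := by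
    rw [← intervalIntegral.integral_const_mul]
    congr 1 with r
    rw [← mul_assoc, ← Real.exp_add]
    congr 2
    ring
  rw [h3] at h2
  rw [h4]
  linarith

lemma integral_exp_neg_mul_sub_le {c t : ℝ} (hc : 0 < c) :
    ∫ r in 0..t, Real.exp (-c * (t - r)) ≤ 1 / c := by
  have hd : ∀ r ∈ uIcc 0 t, HasDerivAt (fun r => Real.exp (-c * (t - r)) / c)
      (Real.exp (-c * (t - r))) r := fun r _ => by
    have := ((((hasDerivAt_id r).const_sub t).const_mul (-c)).exp).div_const c
    simp only [id] at this
    rwa [mul_neg_one, neg_neg, mul_div_assoc, div_self hc.ne', mul_one] at this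
  rw [intervalIntegral.integral_eq_sub_of_hasDerivAt hd
    ((by fun_prop : Continuous fun r => Real.exp (-c * (t - r))).intervalIntegrable _ _)]
  have : 0 ≤ Real.exp (-c * (t - 0)) / c := by positivity
  simp only [sub_self, mul_zero, Real.exp_zero]
  linarith

/-- The exponentially weighted energy of a process with bounded second moment has a bounded mean. -/
lemma lintegral_integral_exp_mul_sq_le {Ω F : Type*} {mΩ : MeasurableSpace Ω} {Pr : Measure Ω}
    [SFinite Pr] [NormedAddCommGroup F] [SecondCountableTopology F] [MeasurableSpace F]
    [BorelSpace F] {ξ : ℝ → Ω → F}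
    (hξc : ∀ ω, Continuous fun t => ξ t ω) (hξm : ∀ t, Measurable (ξ t)) {A : ℝ}
    (hξ : ∀ t, ∫⁻ ω, ‖ξ t ω‖ₑ ^ 2 ∂Pr ≤ ENNReal.ofReal A) {c t : ℝ} (hc : 0 < c) (ht : 0 ≤ t) :
    ∫⁻ ω, ENNReal.ofReal (∫ r in 0..t, Real.exp (-c * (t - r)) * ‖ξ r ω‖ ^ 2) ∂Pr
      ≤ ENNReal.ofReal (A / c) := by
  have hm : Measurable (Function.uncurry ξ) :=
    measurable_uncurry_of_continuous_of_measurable hξc hξm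
  have hcr : ∀ ω, Continuous fun r => Real.exp (-c * (t - r)) * ‖ξ r ω‖ ^ 2 := fun ω => by
    have := hξc ω
    fun_prop
  have h1 : ∀ ω, ENNReal.ofReal (∫ r in 0..t, Real.exp (-c * (t - r)) * ‖ξ r ω‖ ^ 2)
      = ∫⁻ r in Ioc 0 t, ENNReal.ofReal (Real.exp (-c * (t - r))) * ‖ξ r ω‖ₑ ^ 2 := fun ω => by
    rw [intervalIntegral.integral_of_le ht, ofReal_integral_eq_lintegral_ofReal]
    · refine lintegral_congr fun r => ?_
      rw [ENNReal.ofReal_mul (Real.exp_pos _).le, ENNReal.ofReal_pow (norm_nonneg _),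
        ofReal_norm]
    · exact ((hcr ω).intervalIntegrable 0 t).1
    · exact Eventually.of_forall fun r => by positivity
  simp_rw [h1]
  rw [lintegral_lintegral_swap]
  · calc ∫⁻ r in Ioc 0 t, ∫⁻ ω, ENNReal.ofReal (Real.exp (-c * (t - r))) * ‖ξ r ω‖ₑ ^ 2 ∂Pr
        ≤ ∫⁻ r in Ioc 0 t, ENNReal.ofReal (Real.exp (-c * (t - r))) * ENNReal.ofReal A := by
          refine lintegral_mono fun r => ?_
          rw [lintegral_const_mul' _ _ ENNReal.ofReal_ne_top]
          gcongr
          exact hξ r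
      _ = ENNReal.ofReal (∫ r in 0..t, Real.exp (-c * (t - r))) * ENNReal.ofReal A := by
          rw [lintegral_mul_const' _ _ ENNReal.ofReal_ne_top, intervalIntegral.integral_of_le ht,
            ofReal_integral_eq_lintegral_ofReal]
          · exact ((by fun_prop : Continuous fun r =>
              Real.exp (-c * (t - r))).intervalIntegrable 0 t).1
          · exact Eventually.of_forall fun r => by positivity
      _ ≤ ENNReal.ofReal (1 / c) * ENNReal.ofReal A := by
          gcongr
          exact integral_exp_neg_mul_sub_le hc
      _ = ENNReal.ofReal (A / c) := by
          rw [← ENNReal.ofReal_mul (by positivity)]; congr 1; ring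
  · refine Measurable.aemeasurable ?_
    exact (ENNReal.measurable_ofReal.comp (by fun_prop : Measurable fun p : Ω × ℝ =>
      Real.exp (-c * (t - p.2)))).mul (((hm.comp measurable_swap).enorm).pow_const 2)

end Comparison

/-! ### Boundedness of the auxiliary tracking errors -/

section Scalar

/-- The right-hand side is a barrier of growth rate `k + ν`. Where `V` touches it, `V' ≤ k V + C` is
smaller than the slope of the barrier as soon as `C` is below `ν` times its height. The offset `q`
carries the exponent accumulated in earlier phases. -/
lemma le_mul_exp_of_deriv_right_le {V V' : ℝ → ℝ} {k C ν M q s e : ℝ}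
    (hVc : ContinuousOn V (Icc s e)) (hV : ∀ t ∈ Ico s e, HasDerivWithinAt V (V' t) (Ici t) t)
    (hle : ∀ t ∈ Ico s e, V' t ≤ k * V t + C) (hs : V s ≤ M * Real.exp q)
    (hC : ∀ t ∈ Icc s e, C < ν * (M * Real.exp (q + (k + ν) * (t - s)))) :
    ∀ t ∈ Icc s e, V t ≤ M * Real.exp (q + (k + ν) * (t - s)) := by
  have hd : ∀ t : ℝ, HasDerivAt (fun t => M * Real.exp (q + (k + ν) * (t - s)))
      (M * (Real.exp (q + (k + ν) * (t - s)) * (k + ν))) t := fun t => by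
    simpa using
      (((((hasDerivAt_id t).sub_const s).const_mul (k + ν)).const_add q).exp).const_mul M
  refine image_le_of_deriv_right_lt_deriv_boundary hVc hV (by simpa using hs) hd ?_
  intro t ht heq
  have h1 := hle t ht
  have h2 := hC t (Ico_subset_Icc_self ht)
  rw [heq] at h1
  linarith

lemma IsSchedule.exists_mem_Ico {τ τe : ℕ → ℝ} {T : ℝ} (hτ : IsSchedule τ τe T) {t : ℝ}
    (ht : 0 ≤ t) : ∃ κ, t ∈ Ico (τ κ) (τ (κ + 1)) := by
  classical
  have hex : ∃ κ, t < τ κ := (hτ.exhaust.eventually_gt_atTop t).exists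
  have hspec := Nat.find_spec hex
  rcases hk : Nat.find hex with _ | κ
  · rw [hk, hτ.start] at hspec; linarith
  · rw [hk] at hspec
    exact ⟨κ, not_lt.1 (Nat.find_min hex (by omega)), hspec⟩

/-- Barriers of rates `α + ν` and `β + ν` are chained over the two phases. By `hcycle` their total
exponent over a cycle is nonpositive, so the bound `M` passes from each `τ κ` to the next, while
inside a cycle the exponent stays in `[-R, R]`. -/
lemma IsSchedule.bounded_of_deriv_right_le {τ τe : ℕ → ℝ} {T : ℝ} (hτ : IsSchedule τ τe T)
    {V V' : ℝ → ℝ} {α β C ν : ℝ} (hν : 0 < ν) (hC : 0 ≤ C)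
    (hVc : ContinuousOn V (Ici 0)) (hV : ∀ t, 0 ≤ t → HasDerivWithinAt V (V' t) (Ici t) t)
    (hon : ∀ κ, ∀ t ∈ Ico (τ κ) (τe κ), V' t ≤ α * V t + C)
    (hoff : ∀ κ, ∀ t ∈ Ico (τe κ) (τ (κ + 1)), V' t ≤ β * V t + C)
    (hcycle : ∀ κ, α * (τe κ - τ κ) + β * (τ (κ + 1) - τe κ) ≤ -ν * (τ (κ + 1) - τ κ)) :
    ∃ M : ℝ, ∀ t, 0 ≤ t → V t ≤ M := by
  have hT : 0 < T := (hτ.cycle_pos 0).trans_le (hτ.cycle_le 0)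
  have hmono : Monotone τ := monotone_nat_of_le_succ fun κ => by linarith [hτ.cycle_pos κ]
  have hpos : ∀ κ, 0 ≤ τ κ := fun κ => hτ.start ▸ hmono (Nat.zero_le κ)
  set R := (|α| + |β| + 2 * ν) * T with hR
  -- Large enough to dominate `V 0` and to keep `C` below `ν` times the barrier even at its lowest
  -- possible height `M * exp (-R)`.
  set M := max (V 0) 0 + (C + 1) * Real.exp R / ν with hM
  have hMpos : 0 < M := by positivity
  have hCM : ∀ p : ℝ, -R ≤ p → C < ν * (M * Real.exp p) := fun p hp => by
    have h1 : (C + 1) * Real.exp R / ν ≤ M := by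
      rw [hM]; linarith [le_max_right (V 0) 0]
    calc C < C + 1 := lt_add_one C
      _ = ν * ((C + 1) * Real.exp R / ν * Real.exp (-R)) := by
          rw [Real.exp_neg]; field_simp
      _ ≤ ν * (M * Real.exp p) := by gcongr
  have hbd : ∀ {k r : ℝ}, 0 ≤ r → r ≤ T → |(k + ν) * r| ≤ (|k| + ν) * T := fun {k r} h0 h1 => by
    rw [abs_mul, abs_of_nonneg h0]
    gcongr
    exact (abs_add_le _ _).trans (by rw [abs_of_pos hν])
  have hνT : 0 ≤ ν * T := by positivity
  have hαT : 0 ≤ |α| * T := by positivity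
  have hβT : 0 ≤ |β| * T := by positivity
  have hR' : R = |α| * T + |β| * T + 2 * (ν * T) := by rw [hR]; ring
  have hphase : ∀ κ, V (τ κ) ≤ M →
      (∀ t ∈ Icc (τ κ) (τ (κ + 1)), V t ≤ M * Real.exp R) ∧ V (τ (κ + 1)) ≤ M := by
    intro κ hκ
    have h1 := hτ.on_le κ
    have h2 := hτ.off_le κ
    have h3 := hτ.cycle_le κ
    have h0 := hpos κ
    have hα : ∀ t ∈ Icc (τ κ) (τe κ), |(α + ν) * (t - τ κ)| ≤ |α| * T + ν * T := fun t ht =>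
      (hbd (by linarith [ht.1]) (by linarith [ht.2])).trans_eq (by ring)
    have hβ : ∀ t ∈ Icc (τe κ) (τ (κ + 1)), |(β + ν) * (t - τe κ)| ≤ |β| * T + ν * T := fun t ht =>
      (hbd (by linarith [ht.1]) (by linarith [ht.2])).trans_eq (by ring)
    have hON := le_mul_exp_of_deriv_right_le (q := 0) (ν := ν) (M := M) (k := α) (C := C)
      (hVc.mono fun t ht => h0.trans ht.1)
      (fun t ht => hV t (h0.trans ht.1)) (hon κ) (by simpa using hκ)
      (fun t ht => hCM _ (by linarith [(abs_le.1 (hα t ht)).1]))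
    have hαe := hα (τe κ) ⟨h1, le_rfl⟩
    have hOFF := le_mul_exp_of_deriv_right_le (q := 0 + (α + ν) * (τe κ - τ κ)) (ν := ν) (M := M)
      (k := β) (C := C) (hVc.mono fun t ht => (h0.trans h1).trans ht.1)
      (fun t ht => hV t ((h0.trans h1).trans ht.1)) (hoff κ) (hON _ ⟨h1, le_rfl⟩)
      (fun t ht => hCM _ (by linarith [(abs_le.1 (hβ t ht)).1, (abs_le.1 hαe).1]))
    refine ⟨fun t ht => ?_, ?_⟩
    · rcases le_total t (τe κ) with hte | hte
      · refine (hON t ⟨ht.1, hte⟩).trans ?_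
        gcongr
        linarith [(abs_le.1 (hα t ⟨ht.1, hte⟩)).2]
      · refine (hOFF t ⟨hte, ht.2⟩).trans ?_
        gcongr
        linarith [(abs_le.1 (hβ t ⟨hte, ht.2⟩)).2, (abs_le.1 hαe).2]
    · refine (hOFF _ ⟨h2, le_rfl⟩).trans ?_
      have : 0 + (α + ν) * (τe κ - τ κ) + (β + ν) * (τ (κ + 1) - τe κ) ≤ 0 := by
        linarith [hcycle κ]
      exact mul_le_of_le_one_right hMpos.le (Real.exp_le_one_iff.2 this)
  have hnode : ∀ κ, V (τ κ) ≤ M := fun κ => by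
    induction κ with
    | zero =>
      rw [hτ.start, hM]
      have : 0 ≤ (C + 1) * Real.exp R / ν := by positivity
      linarith [le_max_left (V 0) 0]
    | succ κ ih => exact (hphase κ ih).2
  refine ⟨M * Real.exp R, fun t ht => ?_⟩
  obtain ⟨κ, hκ⟩ := hτ.exists_mem_Ico ht
  exact (hphase κ (hnode κ)).1 t (Ico_subset_Icc_self hκ)

end Scalar

/-! ### Quadratic forms, the integrator chain and the matrix inequalities. -/

section Matrices

open Matrix

/-- Subtracting `lambdaMin M` times the identity shifts the spectrum into `[0, ∞)`. -/
lemma lambdaMin_mul_dotProduct_le {N : ℕ} {M : Matrix (Fin N) (Fin N) ℝ} (hM : M.IsHermitian)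
    (x : Fin N → ℝ) : lambdaMin M * (x ⬝ᵥ x) ≤ x ⬝ᵥ M *ᵥ x := by
  have hfin : (spectrum ℝ M).Finite := by
    rw [hM.spectrum_real_eq_range_eigenvalues]; exact finite_range _
  have hps : (M - algebraMap ℝ (Matrix (Fin N) (Fin N) ℝ) (lambdaMin M)).PosSemidef := by
    rw [posSemidef_iff_isHermitian_and_spectrum_nonneg]
    refine ⟨?_, ?_⟩
    · refine hM.sub ?_
      rw [Algebra.algebraMap_eq_smul_one]
      exact isHermitian_one.smul (IsSelfAdjoint.all _)
    · rw [← spectrum.sub_singleton_eq]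
      rintro _ ⟨r, hr, _, rfl, rfl⟩
      exact sub_nonneg.2 (csInf_le hfin.bddBelow hr)
  have := hps.dotProduct_mulVec_nonneg x
  simp only [star_trivial, Algebra.algebraMap_eq_smul_one, sub_mulVec, smul_mulVec, one_mulVec,
    dotProduct_sub, dotProduct_smul, smul_eq_mul] at this
  linarith

lemma lambdaMin_pos {n : ℕ} [NeZero n] {P : Matrix (Fin n) (Fin n) ℝ} (hP : P.PosDef) :
    0 < lambdaMin P := by
  have hr := hP.isHermitian.spectrum_real_eq_range_eigenvalues
  have hmem : lambdaMin P ∈ spectrum ℝ P := by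
    refine Set.Nonempty.csInf_mem ?_ ?_
    · rw [hr]; exact range_nonempty _
    · rw [hr]; exact finite_range _
  rw [hr] at hmem
  obtain ⟨i, hi⟩ := hmem
  rw [← hi]
  exact hP.eigenvalues_pos i

lemma dotProduct_mulVec_comm {n : ℕ} {P : Matrix (Fin n) (Fin n) ℝ} (hP : P.IsHermitian)
    (u v : Fin n → ℝ) : u ⬝ᵥ P *ᵥ v = v ⬝ᵥ P *ᵥ u := by
  have hT : Pᵀ = P := by simpa [IsHermitian, conjTranspose_eq_transpose_of_trivial] using hP
  rw [dotProduct_mulVec, ← mulVec_transpose, hT, dotProduct_comm]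

lemma dotProduct_mulVec_le_specNorm {n : ℕ} (P : Matrix (Fin n) (Fin n) ℝ) (x : Fin n → ℝ) :
    x ⬝ᵥ P *ᵥ x ≤ specNorm P * (x ⬝ᵥ x) := by
  have h1 := inner_toEuclideanCLM P (WithLp.toLp 2 x) (WithLp.toLp 2 x)
  have h2 := real_inner_le_norm (WithLp.toLp 2 x) (toEuclideanCLM (𝕜 := ℝ) P (WithLp.toLp 2 x))
  have h3 := (toEuclideanCLM (𝕜 := ℝ) P).le_opNorm (WithLp.toLp 2 x)
  have h4 : ‖(WithLp.toLp 2 x : EuclideanSpace ℝ (Fin n))‖ ^ 2 = x ⬝ᵥ x := by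
    rw [EuclideanSpace.real_norm_sq_eq]
    simp [dotProduct, sq]
  rw [h1] at h2
  calc x ⬝ᵥ P *ᵥ x
      ≤ ‖(WithLp.toLp 2 x : EuclideanSpace ℝ (Fin n))‖
          * ‖toEuclideanCLM (𝕜 := ℝ) P (WithLp.toLp 2 x)‖ := h2
    _ ≤ ‖(WithLp.toLp 2 x : EuclideanSpace ℝ (Fin n))‖
          * (specNorm P * ‖(WithLp.toLp 2 x : EuclideanSpace ℝ (Fin n))‖) := by
        gcongr; exact h3
    _ = specNorm P * (x ⬝ᵥ x) := by rw [← h4]; ring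

lemma specNorm_pos {n : ℕ} [NeZero n] {P : Matrix (Fin n) (Fin n) ℝ} (hP : P.PosDef) :
    0 < specNorm P := by
  have hx : (Pi.single 0 1 : Fin n → ℝ) ≠ 0 := by simp
  have h1 := hP.dotProduct_mulVec_pos hx
  have h2 := dotProduct_mulVec_le_specNorm P (Pi.single 0 1)
  simp only [star_trivial] at h1
  have h3 : (Pi.single 0 1 : Fin n → ℝ) ⬝ᵥ Pi.single 0 1 = 1 := by simp
  rw [h3, mul_one] at h2
  exact h1.trans_le h2

/-- The vector `B = (0, …, 0, 1)`. -/
def inputVec (n : ℕ) : Fin n → ℝ := fun j => chainB n j 0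

/-- The feedback has rank one: `ζ_i` enters only through the scalar `Bᵀ P ζ_i`. This reduces the
coupling of the network to the scalars `y_i = Bᵀ P x_i`, with no Kronecker products. -/
lemma chainB_mul_gainK_mulVec {n : ℕ} (c0 : ℕ) (P : Matrix (Fin n) (Fin n) ℝ) (v : Fin n → ℝ) :
    (chainB n * gainK c0 P) *ᵥ v = (c0 * (inputVec n ⬝ᵥ P *ᵥ v)) • inputVec n := by
  have h1 : ((chainB n)ᵀ *ᵥ (P *ᵥ v)) = fun _ => inputVec n ⬝ᵥ P *ᵥ v := by
    funext k
    simp [mulVec, inputVec, Subsingleton.elim k 0, dotProduct]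
  rw [← mulVec_mulVec, gainK, smul_mulVec, ← mulVec_mulVec, h1]
  funext j
  simp [mulVec, dotProduct, inputVec]
  ring

lemma chainA_mulVec_apply {n : ℕ} (v : Fin n → ℝ) (j : Fin n) :
    (chainA n *ᵥ v) j = if h : (j : ℕ) + 1 < n then v ⟨j + 1, h⟩ else 0 := by
  simp only [mulVec, dotProduct, chainA, of_apply, ite_mul, one_mul, zero_mul]
  split_ifs with h
  · rw [Finset.sum_eq_single ⟨j + 1, h⟩]
    · simp
    · intro k _ hk
      rw [if_neg]
      exact fun h' => hk (Fin.ext h')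
    · simp
  · refine Finset.sum_eq_zero fun k _ => if_neg ?_
    have := k.isLt
    omega

/-- The leader runs the same integrator chain with input `z_r⁽ⁿ⁾`, so in the tracking error it is
just a bounded disturbance along `B`. -/
lemma hasDerivAt_leaderVec {n : ℕ} {zr : ℝ → ℝ} (hz : ContDiff ℝ n zr) (t : ℝ) :
    HasDerivAt (leaderVec n zr)
      (chainA n *ᵥ leaderVec n zr t + iteratedDeriv n zr t • inputVec n) t := by
  rw [hasDerivAt_pi]
  intro j
  have hd : HasDerivAt (iteratedDeriv j zr) (iteratedDeriv (j + 1) zr t) t := by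
    rw [iteratedDeriv_succ]
    exact ((hz.differentiable_iteratedDeriv j (by exact_mod_cast j.isLt)) t).hasDerivAt
  have e : (chainA n *ᵥ leaderVec n zr t + iteratedDeriv n zr t • inputVec n) j
      = iteratedDeriv (j + 1) zr t := by
    simp only [Pi.add_apply, chainA_mulVec_apply, Pi.smul_apply, inputVec, chainB, of_apply,
      smul_eq_mul, leaderVec]
    have := j.isLt
    by_cases h : (j : ℕ) + 1 < n
    · rw [dif_pos h, if_neg h.ne]; simp
    · have h' : (j : ℕ) + 1 = n := by omega
      rw [dif_neg h, if_pos h', h']; simp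
  rw [e]
  exact hd

variable {n : ℕ} {P : Matrix (Fin n) (Fin n) ℝ} {c1 c3 : ℝ}

lemma dotProduct_lyapunov (hP : P.IsHermitian) (x : Fin n → ℝ) :
    x ⬝ᵥ ((chainA n)ᵀ * P + P * chainA n) *ᵥ x = 2 * (x ⬝ᵥ P *ᵥ (chainA n *ᵥ x)) := by
  rw [add_mulVec, dotProduct_add, ← mulVec_mulVec, ← mulVec_mulVec, mulVec_transpose,
    dotProduct_comm x (_ ᵥ* _), ← dotProduct_mulVec, dotProduct_comm (P *ᵥ x),
    dotProduct_comm (chainA n *ᵥ x), ← dotProduct_comm (chainA n *ᵥ x),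
    dotProduct_mulVec_comm hP (chainA n *ᵥ x)]
  ring

/-- The indefinite term `2 (Bᵀ P x)²` is the one that the coupling compensates in
`consensus_sum_le`. -/
lemma IsRiccati.two_mul_le_on (h : IsRiccati P c1 c3) (x : Fin n → ℝ) :
    2 * (x ⬝ᵥ P *ᵥ (chainA n *ᵥ x))
      ≤ 2 * (inputVec n ⬝ᵥ P *ᵥ x) ^ 2 - c1 * (x ⬝ᵥ x) := by
  have h1 := h.on_mode.posSemidef.dotProduct_mulVec_nonneg x
  have hB : x ⬝ᵥ (P * chainB n * (chainB n)ᵀ * P) *ᵥ x = (inputVec n ⬝ᵥ P *ᵥ x) ^ 2 := by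
    have e1 : ((chainB n)ᵀ *ᵥ (P *ᵥ x)) = fun _ => inputVec n ⬝ᵥ P *ᵥ x := by
      funext k
      simp [mulVec, inputVec, Subsingleton.elim k 0, dotProduct]
    have e2 : chainB n *ᵥ (fun _ => inputVec n ⬝ᵥ P *ᵥ x)
        = (inputVec n ⬝ᵥ P *ᵥ x) • inputVec n := by
      funext j
      simp [mulVec, dotProduct, inputVec]
      ring
    rw [← mulVec_mulVec, ← mulVec_mulVec, ← mulVec_mulVec, e1, e2, mulVec_smul, dotProduct_smul,
      dotProduct_mulVec_comm h.posDef.isHermitian x, smul_eq_mul, sq]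
  simp only [star_trivial, neg_mulVec, dotProduct_neg, add_mulVec _ (c1 • _), sub_mulVec,
    smul_mulVec, one_mulVec, dotProduct_add, dotProduct_sub, dotProduct_smul, smul_eq_mul,
    dotProduct_lyapunov h.posDef.isHermitian, hB] at h1
  linarith

lemma IsRiccati.two_mul_le_off (h : IsRiccati P c1 c3) (x : Fin n → ℝ) :
    2 * (x ⬝ᵥ P *ᵥ (chainA n *ᵥ x)) ≤ c3 * (x ⬝ᵥ P *ᵥ x) := by
  have h1 := h.off_mode.posSemidef.dotProduct_mulVec_nonneg x
  simp only [star_trivial, neg_mulVec, dotProduct_neg, sub_mulVec, smul_mulVec, dotProduct_sub,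
    dotProduct_smul, smul_eq_mul, dotProduct_lyapunov h.posDef.isHermitian] at h1
  linarith

/-- Young's inequality in the metric of `P`: the form is nonnegative at `ν x + d u`; divide by `ν`.
-/
lemma disturbance_le (hP : P.PosDef) {ν : ℝ} (hν : 0 < ν) (x u : Fin n → ℝ) (d : ℝ) :
    -2 * d * (x ⬝ᵥ P *ᵥ u) ≤ ν * (x ⬝ᵥ P *ᵥ x) + d ^ 2 / ν * (u ⬝ᵥ P *ᵥ u) := by
  have h := hP.posSemidef.dotProduct_mulVec_nonneg (ν • x + d • u)
  simp only [star_trivial, mulVec_add, mulVec_smul, dotProduct_add, add_dotProduct, smul_dotProduct,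
    dotProduct_smul, smul_eq_mul, dotProduct_mulVec_comm hP.isHermitian u x] at h
  have h2 := mul_le_mul_of_nonneg_left h (inv_pos.2 hν).le
  rw [mul_zero] at h2
  have e : ν⁻¹ * (ν * (ν * (x ⬝ᵥ P *ᵥ x) + d * (x ⬝ᵥ P *ᵥ u))
      + d * (ν * (x ⬝ᵥ P *ᵥ u) + d * (u ⬝ᵥ P *ᵥ u)))
      = ν * (x ⬝ᵥ P *ᵥ x) + 2 * d * (x ⬝ᵥ P *ᵥ u) + d ^ 2 / ν * (u ⬝ᵥ P *ᵥ u) := by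
    field_simp
    ring
  rw [e] at h2
  linarith

end Matrices

/-! ### Lyapunov estimate for the network of auxiliary trajectories. -/

section Auxiliary

open Matrix

lemma hasDerivWithinAt_dotProduct_mulVec {n : ℕ} {P : Matrix (Fin n) (Fin n) ℝ}
    (hP : P.IsHermitian) {x : ℝ → Fin n → ℝ} {x' : Fin n → ℝ} {s : Set ℝ} {t : ℝ}
    (h : HasDerivWithinAt x x' s t) :
    HasDerivWithinAt (fun t => x t ⬝ᵥ P *ᵥ x t) (2 * (x t ⬝ᵥ P *ᵥ x')) s t := by
  have hc := hasDerivWithinAt_pi.1 h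
  have hPx : ∀ i, HasDerivWithinAt (fun t => (P *ᵥ x t) i) ((P *ᵥ x') i) s t := fun i => by
    simp only [mulVec, dotProduct]
    exact HasDerivWithinAt.fun_sum fun j _ => (hc j).const_mul (P i j)
  have hsum : HasDerivWithinAt (fun t => x t ⬝ᵥ P *ᵥ x t)
      (∑ i, (x' i * (P *ᵥ x t) i + x t i * (P *ᵥ x') i)) s t :=
    HasDerivWithinAt.fun_sum fun i _ => (hc i).mul (hPx i)
  convert hsum using 1
  rw [Finset.sum_add_distrib]
  change _ = x' ⬝ᵥ P *ᵥ x t + x t ⬝ᵥ P *ᵥ x'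
  rw [dotProduct_mulVec_comm hP x']
  ring

variable {N n : ℕ} {a : Matrix (Fin N) (Fin N) ℝ} {b : Fin N → ℝ}

lemma IsNetwork.isHermitian (hnet : IsNetwork a b) : (laplacian a + diagonal b).IsHermitian := by
  have ha : a.IsHermitian := by
    rw [IsHermitian, conjTranspose_eq_transpose_of_trivial]; exact hnet.symm
  refine IsHermitian.add (IsHermitian.sub ?_ ha) ?_ <;>
  · rw [IsHermitian, conjTranspose_eq_transpose_of_trivial, diagonal_transpose]

lemma laplacian_quadratic (y : Fin N → ℝ) :
    ∑ i, y i * (∑ j, a i j * (y j - y i) - b i * y i)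
      = -(y ⬝ᵥ (laplacian a + diagonal b) *ᵥ y) := by
  rw [dotProduct, ← Finset.sum_neg_distrib]
  refine Finset.sum_congr rfl fun i _ => ?_
  have h1 : ((laplacian a + diagonal b) *ᵥ y) i
      = (∑ j, a i j) * y i - ∑ j, a i j * y j + b i * y i := by
    rw [add_mulVec, Pi.add_apply, laplacian, sub_mulVec, Pi.sub_apply, mulVec_diagonal,
      mulVec_diagonal]
    rfl
  have h2 : ∑ j, a i j * (y j - y i) = ∑ j, a i j * y j - (∑ j, a i j) * y i := by
    rw [Finset.sum_mul, ← Finset.sum_sub_distrib]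
    exact Finset.sum_congr rfl fun j _ => by ring
  rw [h1, h2]
  ring

/-- The sum is `-2 c₀ yᵀ(ℒ + ℬ)y`, and the gain condition on `c₀` makes it at most `-2 yᵀy`, exactly
what cancels the indefinite terms of the Riccati inequality. -/
lemma consensus_sum_le (hnet : IsNetwork a b) {c0 : ℝ} (hc0 : 0 ≤ c0)
    (hgain : 1 ≤ c0 * lambdaMin (laplacian a + diagonal b)) (y : Fin N → ℝ) :
    ∑ i, 2 * (y i * (c0 * (∑ j, a i j * (y j - y i) - b i * y i))) ≤ -∑ i, 2 * y i ^ 2 := by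
  have h1 := lambdaMin_mul_dotProduct_le hnet.isHermitian y
  have h2 : 0 ≤ y ⬝ᵥ y := Finset.sum_nonneg fun i _ => mul_self_nonneg (y i)
  have h3 : ∑ i, 2 * (y i * (c0 * (∑ j, a i j * (y j - y i) - b i * y i)))
      = 2 * c0 * -(y ⬝ᵥ (laplacian a + diagonal b) *ᵥ y) := by
    rw [← laplacian_quadratic, Finset.mul_sum]
    exact Finset.sum_congr rfl fun i _ => by ring
  have h4 : ∑ i, 2 * y i ^ 2 = 2 * (y ⬝ᵥ y) := by
    rw [dotProduct, Finset.mul_sum]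
    exact Finset.sum_congr rfl fun i _ => by ring
  rw [h3, h4]
  have h5 := mul_le_mul_of_nonneg_left h1 hc0
  have h6 := mul_le_mul_of_nonneg_right hgain h2
  linarith

lemma IsSchedule.not_on {τ τe : ℕ → ℝ} {T : ℝ} (hτ : IsSchedule τ τe T) {κ : ℕ} {t : ℝ}
    (ht : t ∈ Ico (τe κ) (τ (κ + 1))) : ¬∃ κ', t ∈ Ico (τ κ') (τe κ') := by
  rintro ⟨κ', h1, h2⟩
  have hmono : Monotone τ := monotone_nat_of_le_succ fun κ => by linarith [hτ.cycle_pos κ]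
  rcases lt_trichotomy κ' κ with h | rfl | h
  · have := hmono (Nat.succ_le_of_lt h)
    linarith [hτ.off_le κ', hτ.on_le κ, ht.1]
  · linarith [ht.1]
  · have := hmono (Nat.succ_le_of_lt h)
    linarith [ht.2]

/-- The auxiliary trajectories stay at a bounded distance from the leader. -/
theorem exists_bound_auxiliary_sub_leaderVec [NeZero N] [NeZero n] (hnet : IsNetwork a b)
    {zr : ℝ → ℝ} {cz : ℝ} (hzr : IsLeader n zr cz) {τ τe : ℕ → ℝ} {T : ℝ}
    (hτ : IsSchedule τ τe T) {P : Matrix (Fin n) (Fin n) ℝ} {c0 : ℕ} {c1 c2 c3 : ℝ}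
    (hc1 : 0 < c1) (hc2 : 0 < c2) (hP : IsRiccati P c1 c3)
    (hgain : 1 ≤ (c0 : ℝ) * lambdaMin (laplacian a + diagonal b))
    (hcond : ∀ κ : ℕ, 0 < (deltaOn N P cz c1 c2 + deltaOff N cz c2 c3) * (τe κ - τ κ)
      - deltaOff N cz c2 c3 * (τ (κ + 1) - τ κ))
    {η : Fin N → ℝ → (Fin n → ℝ)} (hη : IsAuxiliary a b zr τ τe (gainK c0 P) η) :
    ∃ M : ℝ, ∀ t, 0 ≤ t → ∀ i j, |η i t j - leaderVec n zr t j| ≤ M := by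
  have hPh := hP.posDef.isHermitian
  have hN : (0 : ℝ) < N := by exact_mod_cast Nat.pos_of_ne_zero (NeZero.ne N)
  have hnP := specNorm_pos hP.posDef
  have hcz := hzr.cz_pos
  set β := inputVec n
  set x : Fin N → ℝ → Fin n → ℝ := fun i t => η i t - leaderVec n zr t with hx
  set ζ : Fin N → ℝ → Fin n → ℝ := fun i t => virtualSignal a b zr τ τe η i t with hζ
  set d : ℝ → ℝ := iteratedDeriv n zr
  set x' : Fin N → ℝ → Fin n → ℝ := fun i t =>
    chainA n *ᵥ x i t + (c0 * (β ⬝ᵥ P *ᵥ ζ i t)) • β - d t • β with hx'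
  have hdx : ∀ i t, 0 ≤ t → HasDerivWithinAt (x i) (x' i t) (Ici t) t := by
    intro i t ht
    have := ((hη i).2 t ht).sub (hasDerivAt_leaderVec hzr.contDiff t).hasDerivWithinAt
    rw [chainB_mul_gainK_mulVec] at this
    refine this.congr_deriv ?_
    simp only [hx', hx, mulVec_sub]
    abel
  set V : ℝ → ℝ := fun t => ∑ i, x i t ⬝ᵥ P *ᵥ x i t with hV
  have hdV : ∀ t, 0 ≤ t →
      HasDerivWithinAt V (∑ i, 2 * (x i t ⬝ᵥ P *ᵥ x' i t)) (Ici t) t := fun t ht =>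
    HasDerivWithinAt.fun_sum fun i _ => hasDerivWithinAt_dotProduct_mulVec hPh (hdx i t ht)
  have hcx : ∀ i, ContinuousOn (x i) (Ici 0) := fun i =>
    (hη i).1.sub fun t _ =>
      (hasDerivAt_leaderVec hzr.contDiff t).continuousAt.continuousWithinAt
  have hcV : ContinuousOn V (Ici 0) := by
    refine continuousOn_finsetSum _ fun i _ => ?_
    exact ((by fun_prop : Continuous fun y : Fin n → ℝ => y ⬝ᵥ P *ᵥ y)).comp_continuousOn (hcx i)
  set μ := cz * N / c2 with hμ
  have hμ0 : 0 < μ := by positivity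
  -- The disturbance is absorbed with Young weight `μ / 2`. Since `deltaOn` and `deltaOff` allow for
  -- a full `μ`, the other half remains as the decay margin `ν` over a cycle.
  have hν : 0 < μ / 2 := by positivity
  set C := ∑ _i : Fin N, cz ^ 2 / (μ / 2) * (β ⬝ᵥ P *ᵥ β) with hC
  have hβP : 0 ≤ β ⬝ᵥ P *ᵥ β := hP.posDef.posSemidef.dotProduct_mulVec_nonneg β
  have hC0 : 0 ≤ C := Finset.sum_nonneg fun i _ => by positivity
  have hexp : ∀ i t, 2 * (x i t ⬝ᵥ P *ᵥ x' i t) = 2 * (x i t ⬝ᵥ P *ᵥ (chainA n *ᵥ x i t))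
      + 2 * ((β ⬝ᵥ P *ᵥ x i t) * (c0 * (β ⬝ᵥ P *ᵥ ζ i t)))
      + -2 * d t * (x i t ⬝ᵥ P *ᵥ β) := fun i t => by
    simp only [hx', mulVec_sub, mulVec_add, mulVec_smul, dotProduct_sub, dotProduct_add,
      dotProduct_smul, smul_eq_mul, dotProduct_mulVec_comm hPh β (x i t)]
    ring
  have hdist : ∀ i t, 0 ≤ t → -2 * d t * (x i t ⬝ᵥ P *ᵥ β)
      ≤ μ / 2 * (x i t ⬝ᵥ P *ᵥ x i t) + cz ^ 2 / (μ / 2) * (β ⬝ᵥ P *ᵥ β) := fun i t ht => by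
    refine (disturbance_le hP.posDef hν _ _ _).trans ?_
    have : d t ^ 2 ≤ cz ^ 2 :=
      sq_le_sq' (abs_le.1 (hzr.bound n (NeZero.pos n) le_rfl t ht)).1
        (abs_le.1 (hzr.bound n (NeZero.pos n) le_rfl t ht)).2
    gcongr
  have hpos : ∀ κ, 0 ≤ τ κ := fun κ => by
    have hmono : Monotone τ := monotone_nat_of_le_succ fun κ => by linarith [hτ.cycle_pos κ]
    exact hτ.start ▸ hmono (Nat.zero_le κ)
  obtain ⟨M, hM⟩ := hτ.bounded_of_deriv_right_le (V := V)
    (V' := fun t => ∑ i, 2 * (x i t ⬝ᵥ P *ᵥ x' i t)) (α := -(c1 / specNorm P) + μ / 2)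
    (β := c3 + μ / 2) (C := C) hν hC0 hcV hdV
    (fun κ t ht => by
      have ht0 : 0 ≤ t := (hpos κ).trans ht.1
      -- The leader cancels in the differences, so `ζ_i` is a function of the tracking errors alone.
      have hζon : ∀ i, β ⬝ᵥ P *ᵥ ζ i t = ∑ j, a i j * (β ⬝ᵥ P *ᵥ x j t - β ⬝ᵥ P *ᵥ x i t)
          - b i * (β ⬝ᵥ P *ᵥ x i t) := fun i => by
        have h1 : ζ i t = ∑ j, a i j • (x j t - x i t) - b i • x i t := by
          simp only [hζ, virtualSignal]
          rw [if_pos ⟨κ, ht⟩]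
          simp only [hx, sub_sub_sub_cancel_right]
          rw [← neg_sub (leaderVec n zr t), smul_neg, sub_neg_eq_add]
        rw [h1, mulVec_sub, dotProduct_sub, mulVec_smul, dotProduct_smul, mulVec_sum,
          dotProduct_sum, smul_eq_mul]
        simp only [mulVec_smul, dotProduct_smul, mulVec_sub, dotProduct_sub, smul_eq_mul]
      have hsum := consensus_sum_le hnet (Nat.cast_nonneg c0) hgain fun i => β ⬝ᵥ P *ᵥ x i t
      have hVn : V t ≤ specNorm P * ∑ i, x i t ⬝ᵥ x i t := by
        rw [Finset.mul_sum]
        exact Finset.sum_le_sum fun i _ => dotProduct_mulVec_le_specNorm P (x i t)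
      have hdiv : c1 / specNorm P * V t ≤ c1 * ∑ i, x i t ⬝ᵥ x i t := by
        rw [div_mul_eq_mul_div, div_le_iff₀ hnP]
        nlinarith
      calc ∑ i, 2 * (x i t ⬝ᵥ P *ᵥ x' i t)
          ≤ ∑ i, ((2 * (β ⬝ᵥ P *ᵥ x i t) ^ 2 - c1 * (x i t ⬝ᵥ x i t))
              + 2 * ((β ⬝ᵥ P *ᵥ x i t) * (c0 * (β ⬝ᵥ P *ᵥ ζ i t)))
              + (μ / 2 * (x i t ⬝ᵥ P *ᵥ x i t) + cz ^ 2 / (μ / 2) * (β ⬝ᵥ P *ᵥ β))) := by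
            refine Finset.sum_le_sum fun i _ => ?_
            rw [hexp]
            linarith [hP.two_mul_le_on (x i t), hdist i t ht0]
        _ = ∑ i, 2 * (β ⬝ᵥ P *ᵥ x i t) ^ 2 - c1 * ∑ i, x i t ⬝ᵥ x i t
              + ∑ i, 2 * ((β ⬝ᵥ P *ᵥ x i t) * (c0 * (β ⬝ᵥ P *ᵥ ζ i t)))
              + (μ / 2 * V t + C) := by
            simp only [Finset.sum_add_distrib, Finset.sum_sub_distrib, Finset.mul_sum, hV, hC]
        _ ≤ (-(c1 / specNorm P) + μ / 2) * V t + C := by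
            simp only [hζon]
            linarith)
    (fun κ t ht => by
      have ht0 : 0 ≤ t := ((hpos κ).trans (hτ.on_le κ)).trans ht.1
      have hζoff : ∀ i, ζ i t = 0 := fun i => by
        simp only [hζ, virtualSignal]
        exact if_neg (hτ.not_on ht)
      calc ∑ i, 2 * (x i t ⬝ᵥ P *ᵥ x' i t)
          ≤ ∑ i, (c3 * (x i t ⬝ᵥ P *ᵥ x i t)
              + (μ / 2 * (x i t ⬝ᵥ P *ᵥ x i t) + cz ^ 2 / (μ / 2) * (β ⬝ᵥ P *ᵥ β))) := by
            refine Finset.sum_le_sum fun i _ => ?_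
            rw [hexp, hζoff]
            simp only [mulVec_zero, dotProduct_zero, mul_zero, add_zero]
            linarith [hP.two_mul_le_off (x i t), hdist i t ht0]
        _ = (c3 + μ / 2) * V t + C := by
            simp only [Finset.sum_add_distrib, ← Finset.mul_sum, hV, hC]
            ring)
    (fun κ => by
      have h := hcond κ
      have e : deltaOn N P cz c1 c2 = c1 / specNorm P - μ := by
        rw [deltaOn, hμ]; field_simp
      rw [e, deltaOff, ← hμ] at h
      linarith)
  have hl := lambdaMin_pos hP.posDef
  refine ⟨Real.sqrt (M / lambdaMin P), fun t ht i j => Real.abs_le_sqrt ?_⟩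
  rw [le_div_iff₀ hl]
  calc (η i t j - leaderVec n zr t j) ^ 2 * lambdaMin P
      = lambdaMin P * (x i t j * x i t j) := by simp only [hx, Pi.sub_apply]; ring
    _ ≤ lambdaMin P * (x i t ⬝ᵥ x i t) := by
        gcongr
        exact Finset.single_le_sum (f := fun j => x i t j * x i t j)
          (fun j _ => mul_self_nonneg _) (Finset.mem_univ j)
    _ ≤ x i t ⬝ᵥ P *ᵥ x i t := lambdaMin_mul_dotProduct_le hPh _
    _ ≤ V t := Finset.single_le_sum (f := fun i => x i t ⬝ᵥ P *ᵥ x i t)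
          (fun i _ => hP.posDef.posSemidef.dotProduct_mulVec_nonneg (x i t)) (Finset.mem_univ i)
    _ ≤ M := hM t ht

end Auxiliary

/-! ### Regularity of the closed loop -/

section LocallyLipschitz

variable {X : Type*} [PseudoMetricSpace X]

lemma locallyLipschitz_pi {ι : Type*} [Fintype ι] {Y : ι → Type*} [∀ i, PseudoMetricSpace (Y i)]
    {F : X → ∀ i, Y i} (h : ∀ i, LocallyLipschitz fun x => F x i) : LocallyLipschitz F := by
  intro x
  choose K t ht hK using fun i => h i x
  refine ⟨Finset.univ.sup K, ⋂ i, t i, iInter_mem.2 ht, fun y hy z hz => edist_pi_le_iff.2 fun i => ?_⟩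
  refine (hK i (mem_iInter.1 hy i) (mem_iInter.1 hz i)).trans ?_
  gcongr
  exact Finset.le_sup (Finset.mem_univ i)

lemma locallyLipschitz_smul {E : Type*} [NormedAddCommGroup E] [NormedSpace ℝ E] {f : X → ℝ}
    {g : X → E} (hf : LocallyLipschitz f) (hg : LocallyLipschitz g) :
    LocallyLipschitz fun x => f x • g x :=
  (ContDiff.locallyLipschitz (𝕂 := ℝ) (contDiff_smul (𝕜 := ℝ) (F := E))).comp (hf.prodMk hg)

lemma locallyLipschitz_inner {E : Type*} [NormedAddCommGroup E] [InnerProductSpace ℝ E] {f g : X → E}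
    (hf : LocallyLipschitz f) (hg : LocallyLipschitz g) :
    LocallyLipschitz fun x => inner ℝ (f x) (g x) :=
  (ContDiff.locallyLipschitz (𝕂 := ℝ) (contDiff_inner (𝕜 := ℝ) (E := E))).comp (hf.prodMk hg)

end LocallyLipschitz

section Regularity

variable {n m : ℕ} (ag : Agent n m) (D : Design n)

lemma contDiff_phi (q : Fin n) :
    ContDiff ℝ 1 fun p : State D.L × (Fin n → ℝ) => phi D q p.1 p.2 := by
  rw [contDiff_piLp]
  intro k
  have h := D.input_contDiff q
  exact (((h.sub contDiff_const).norm_sq ℝ).div_const _).neg.exp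

lemma contDiff_partialState (q : Fin n) :
    ContDiff ℝ 1 fun x : Fin n → ℝ => partialState x q := by
  unfold partialState
  fun_prop

lemma contDiff_weight (q : Fin n) : ContDiff ℝ 1 fun s : State D.L => s.2 q :=
  (ContinuousLinearMap.proj (R := ℝ) (φ := fun q => EuclideanSpace ℝ (Fin (D.L q))) q).contDiff.comp
    contDiff_snd

lemma norm_phi_le (q : Fin n) (s : State D.L) (η : Fin n → ℝ) :
    ‖phi D q s η‖ ≤ Real.sqrt (D.L q) := by
  refine Real.le_sqrt_of_sq_le ?_
  rw [EuclideanSpace.real_norm_sq_eq]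
  calc ∑ k, (phi D q s η k) ^ 2 ≤ ∑ _k : Fin (D.L q), (1 : ℝ) := by
        refine Finset.sum_le_sum fun k _ => ?_
        have h1 : phi D q s η k ≤ 1 := Real.exp_le_one_iff.2 (neg_nonpos.2 (by positivity))
        have h0 : 0 ≤ phi D q s η k := (Real.exp_pos _).le
        exact pow_le_one₀ h0 h1
    _ = D.L q := by simp

/-- The maps that are differentiable and locally Lipschitz. -/
def IsTame {E F : Type*} [NormedAddCommGroup E] [NormedSpace ℝ E] [NormedAddCommGroup F]
    [NormedSpace ℝ F] (f : E → F) : Prop :=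
  Differentiable ℝ f ∧ LocallyLipschitz f

section Tame

variable {E F G : Type*} [NormedAddCommGroup E] [NormedSpace ℝ E] [NormedAddCommGroup F]
    [NormedSpace ℝ F] [NormedAddCommGroup G] [NormedSpace ℝ G]

lemma isTame_of_contDiff {f : E → F} (hf : ContDiff ℝ 1 f) : IsTame f :=
  ⟨hf.differentiable (by simp), hf.locallyLipschitz⟩

lemma IsTame.comp {g : F → G} {f : E → F} (hg : IsTame g) (hf : IsTame f) :
    IsTame fun x => g (f x) :=
  ⟨hg.1.comp hf.1, hg.2.comp hf.2⟩

lemma IsTame.prodMk {f : E → F} {g : E → G} (hf : IsTame f) (hg : IsTame g) :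
    IsTame fun x => (f x, g x) :=
  ⟨hf.1.prodMk hg.1, hf.2.prodMk hg.2⟩

lemma IsTame.sub {f g : E → F} (hf : IsTame f) (hg : IsTame g) : IsTame fun x => f x - g x :=
  (isTame_of_contDiff (contDiff_fst.sub contDiff_snd)).comp (hf.prodMk hg)

lemma IsTame.mul {f g : E → ℝ} (hf : IsTame f) (hg : IsTame g) : IsTame fun x => f x * g x :=
  (isTame_of_contDiff (contDiff_fst.mul contDiff_snd)).comp (hf.prodMk hg)

end Tame

lemma isTame_g (q : Fin n) :
    IsTame fun p : State D.L × (Fin n → ℝ) => ag.g q (partialState p.1.1 q) :=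
  IsTame.comp ⟨ag.g_differentiable q, ag.g_locallyLipschitz q⟩
    (isTame_of_contDiff ((contDiff_partialState q).comp (contDiff_fst.comp contDiff_fst)))

lemma isTame_controlLaw (q : Fin n) {e : State D.L × (Fin n → ℝ) → ℝ} (he : IsTame e) :
    IsTame fun p : State D.L × (Fin n → ℝ) => controlLaw ag D p.1 p.2 q (e p) := by
  have h1 : IsTame fun p : State D.L × (Fin n → ℝ) =>
      -(D.gain q + D.rho q ^ 2 / 2 * ‖ag.g q (partialState p.1.1 q)‖ ^ 2) := by
    have h : ContDiff ℝ 1 fun v : EuclideanSpace ℝ (Fin m) =>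
        -(D.gain q + D.rho q ^ 2 / 2 * ‖v‖ ^ 2) :=
      (contDiff_const.add (contDiff_const.mul (contDiff_norm_sq ℝ))).neg
    exact (isTame_of_contDiff h).comp (isTame_g ag D q)
  have h2 : IsTame fun p : State D.L × (Fin n → ℝ) => inner ℝ (p.1.2 q) (phi D q p.1 p.2) := by
    exact isTame_of_contDiff
      (ContDiff.inner ℝ ((contDiff_weight D q).comp contDiff_fst) (contDiff_phi D q))
  exact (h1.mul he).sub h2

lemma isTame_err : ∀ (q : ℕ) (hq : q < n),
    IsTame fun p : State D.L × (Fin n → ℝ) => err ag D p.1 p.2 q hq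
  | 0, h => by
    simp only [err]
    refine isTame_of_contDiff ?_
    fun_prop
  | q + 1, h => by
    simp only [err]
    refine IsTame.sub (isTame_of_contDiff (by fun_prop))
      (isTame_controlLaw ag D _ (isTame_err q (Nat.lt_of_succ_lt h)))

/-- Both halves of `IsTame` matter: local Lipschitz continuity for well-posedness, differentiability
so that the derivative of `α` in `fbar` is genuine. As `g` need not be `C¹`, smoothness of `α` is
not available. -/
lemma isTame_alpha (q : Fin n) :
    IsTame fun p : State D.L × (Fin n → ℝ) => alpha ag D p.1 p.2 q :=
  isTame_controlLaw ag D q (isTame_err ag D q q.isLt)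

lemma locallyLipschitz_state_signal :
    LocallyLipschitz fun p : State D.L × ((Fin n → ℝ) × EuclideanSpace ℝ (Fin m)) =>
      ((p.1, p.2.1) : State D.L × (Fin n → ℝ)) :=
  ContDiff.locallyLipschitz (𝕂 := ℝ) (contDiff_fst.prodMk (contDiff_fst.comp contDiff_snd))

lemma locallyLipschitz_closedLoop_fst (q : Fin n) :
    LocallyLipschitz fun p : State D.L × ((Fin n → ℝ) × EuclideanSpace ℝ (Fin m)) =>
      (closedLoop ag D p.1 p.2.1 p.2.2).1 q := by
  have h1 : LocallyLipschitz fun p : State D.L × (Fin n → ℝ) =>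
      (if h : (q : ℕ) + 1 < n then p.1.1 ⟨(q : ℕ) + 1, h⟩ else alpha ag D p.1 p.2 q)
        + ag.f q (partialState p.1.1 q) := by
    refine LocallyLipschitz.add ?_ ?_
    · split_ifs with h
      · exact ContDiff.locallyLipschitz (𝕂 := ℝ) (by fun_prop)
      · exact (isTame_alpha ag D q).2
    · exact (((ag.f_smooth q).of_le (by exact_mod_cast le_top)).comp
        ((contDiff_partialState q).comp (contDiff_fst.comp contDiff_fst))).locallyLipschitz
  have h2 : LocallyLipschitz fun p : State D.L × ((Fin n → ℝ) × EuclideanSpace ℝ (Fin m)) =>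
      p.2.2 :=
    ContDiff.locallyLipschitz (𝕂 := ℝ) (contDiff_snd.comp contDiff_snd)
  have h3 := (isTame_g ag D q).2.comp (locallyLipschitz_state_signal (m := m) D)
  exact (h1.comp (locallyLipschitz_state_signal D)).add (locallyLipschitz_inner h3 h2)

lemma locallyLipschitz_closedLoop_snd (q : Fin n) :
    LocallyLipschitz fun p : State D.L × ((Fin n → ℝ) × EuclideanSpace ℝ (Fin m)) =>
      (closedLoop ag D p.1 p.2.1 p.2.2).2 q := by
  have h1 := locallyLipschitz_smul (isTame_err ag D q q.isLt).2 (contDiff_phi D q).locallyLipschitz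
  have h2 : LocallyLipschitz fun p : State D.L × (Fin n → ℝ) => -(D.sigma q • p.1.2 q) :=
    ContDiff.locallyLipschitz (𝕂 := ℝ)
      (((contDiff_weight D q).comp contDiff_fst).const_smul (D.sigma q)).neg
  have h3 := (locallyLipschitz_smul (LocallyLipschitz.const (D.gamma q)) (h1.add h2)).comp
    (locallyLipschitz_state_signal (m := m) D)
  simpa only [closedLoop, sub_eq_add_neg] using! h3

lemma locallyLipschitz_closedLoop :
    LocallyLipschitz fun p : State D.L × ((Fin n → ℝ) × EuclideanSpace ℝ (Fin m)) =>
      closedLoop ag D p.1 p.2.1 p.2.2 :=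
  (locallyLipschitz_pi (locallyLipschitz_closedLoop_fst ag D)).prodMk
    (locallyLipschitz_pi (locallyLipschitz_closedLoop_snd ag D))

end Regularity

/-! ### Error dynamics and Lyapunov function -/

section Lyapunov

variable {n m : ℕ} (ag : Agent n m) (D : Design n)

/-- The error that follows `err q`, or `0` if there is none. -/
noncomputable def nextErr (s : State D.L) (η : Fin n → ℝ) (q : Fin n) : ℝ :=
  if h : (q : ℕ) + 1 < n then err ag D s η (q + 1) h else 0

/-- With the convention that the error after the last one is `0`, the identity `x_{q+1} = e_{q+1} +
α_q` and the last equation, where `u = α_n`, take one common form. -/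
lemma closedLoop_fst_eq (s : State D.L) (η : Fin n → ℝ) (ξ : EuclideanSpace ℝ (Fin m))
    (q : Fin n) :
    (closedLoop ag D s η ξ).1 q = nextErr ag D s η q + alpha ag D s η q
      + ag.f q (partialState s.1 q) + inner ℝ (ag.g q (partialState s.1 q)) ξ := by
  simp only [closedLoop, nextErr]
  congr 2
  split_ifs with h
  · simp only [err, alpha]; ring
  · ring

/-- The derivative of the previous virtual input is never expanded: it is part of `fbar`. For the
first error this role is played by `η_1' = η_2`. -/
lemma hasDerivWithinAt_err (hn : 2 ≤ n) {η : ℝ → Fin n → ℝ} {X : ℝ → State D.L}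
    {ξ : EuclideanSpace ℝ (Fin m)} {η' : Fin n → ℝ} {t : ℝ}
    (hX : HasDerivWithinAt X (closedLoop ag D (X t) (η t) ξ) (Ici t) t)
    (hη : HasDerivWithinAt η η' (Ici t) t)
    (hη' : η' ⟨0, Nat.lt_of_lt_of_le Nat.zero_lt_two hn⟩ = η t ⟨1, hn⟩) (q : Fin n) :
    HasDerivWithinAt (fun r => err ag D (X r) (η r) q q.isLt)
      (nextErr ag D (X t) (η t) q
        - (D.gain q + D.rho q ^ 2 / 2 * ‖ag.g q (partialState (X t).1 q)‖ ^ 2)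
            * err ag D (X t) (η t) q q.isLt
        - inner ℝ ((X t).2 q) (phi D q (X t) (η t))
        + inner ℝ (ag.g q (partialState (X t).1 q)) ξ
        + fbar ag D hn η X t q) (Ici t) t := by
  have hx : HasDerivWithinAt (fun r => (X r).1 q) ((closedLoop ag D (X t) (η t) ξ).1 q)
      (Ici t) t := hasDerivWithinAt_pi.1 hX.fst q
  have halpha : alpha ag D (X t) (η t) q
      = -(D.gain q + D.rho q ^ 2 / 2 * ‖ag.g q (partialState (X t).1 q)‖ ^ 2)
            * err ag D (X t) (η t) q q.isLt
        - inner ℝ ((X t).2 q) (phi D q (X t) (η t)) := rfl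
  rw [closedLoop_fst_eq, halpha] at hx
  obtain ⟨k, hk⟩ := q
  rcases k with _ | k
  · have hη0 := hasDerivWithinAt_pi.1 hη ⟨0, hk⟩
    rw [hη'] at hη0
    refine (hx.sub hη0).congr_deriv ?_
    simp only [fbar, if_true]
    ring
  -- Needed for `derivWithin` in `fbar` to be the actual right derivative and not the default value
  -- `0`.
  · have hdiff : DifferentiableWithinAt ℝ
        (fun r => alpha ag D (X r) (η r) ⟨k, Nat.lt_of_succ_lt hk⟩) (Ici t) t :=
      ((isTame_alpha ag D ⟨k, Nat.lt_of_succ_lt hk⟩).1 (X t, η t)).comp_differentiableWithinAt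
        (f := fun r => (X r, η r)) t
        (hX.differentiableWithinAt.prodMk hη.differentiableWithinAt)
    refine (hx.sub hdiff.hasDerivWithinAt).congr_deriv ?_
    simp only [fbar, Nat.add_eq_zero_iff, one_ne_zero, and_false, if_false, Nat.add_sub_cancel]
    ring

lemma hasDerivWithinAt_weight_error (θ : Weights D.L) {η : Fin n → ℝ} {X : ℝ → State D.L}
    {ξ : EuclideanSpace ℝ (Fin m)} {t : ℝ} {S : Set ℝ}
    (hX : HasDerivWithinAt X (closedLoop ag D (X t) η ξ) S t) (q : Fin n) :
    HasDerivWithinAt (fun r => θ q - (X r).2 q)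
      (-(D.gamma q • (err ag D (X t) η q q.isLt • phi D q (X t) η - D.sigma q • (X t).2 q))) S t :=
  (hasDerivWithinAt_pi.1 hX.snd q).const_sub (θ q)

/-- The dissipation of one error subsystem. -/
lemma subsystem_dissipation {F G : Type*} [NormedAddCommGroup F] [InnerProductSpace ℝ F]
    [NormedAddCommGroup G] [InnerProductSpace ℝ G] {e e' K ρ γ σ f εs k : ℝ} {g ξ : F}
    {θ θh φ : G} (hρ : 0 < ρ) (hγ : 0 < γ) (hσ : 0 < σ) (hk : 0 < k) (hkK : k ≤ K)
    (hf : |f - inner ℝ θ φ| ^ 2 ≤ εs) :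
    2 * e * (e' - (K + ρ ^ 2 / 2 * ‖g‖ ^ 2) * e - inner ℝ θh φ + inner ℝ g ξ + f)
        + γ⁻¹ * (2 * inner ℝ (θ - θh) (-(γ • (e • φ - σ • θh))))
      ≤ -k * e ^ 2 + 2 / k * e' ^ 2 - σ * ‖θ - θh‖ ^ 2 + 1 / ρ ^ 2 * ‖ξ‖ ^ 2
        + (2 / k * εs + σ * ‖θ‖ ^ 2) := by
  -- Of the damping `2 k e²`, one `k / 2` pays for the next error and one for the approximation
  -- error. Of the remaining `k e²`, half will absorb the coupling terms in the weighted sum.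
  have h1 : 2 * e * e' ≤ k / 2 * e ^ 2 + 2 / k * e' ^ 2 := by
    have h : k / 2 * e ^ 2 + 2 / k * e' ^ 2 - 2 * e * e' = 2 / k * (k / 2 * e - e') ^ 2 := by
      field_simp; ring
    have : 0 ≤ 2 / k * (k / 2 * e - e') ^ 2 := by positivity
    linarith
  have h2 : 2 * e * (f - inner ℝ θ φ) ≤ k / 2 * e ^ 2 + 2 / k * εs := by
    set w := f - inner ℝ θ φ
    have hw : w ^ 2 ≤ εs := by rwa [sq_abs] at hf
    have h : k / 2 * e ^ 2 + 2 / k * w ^ 2 - 2 * e * w = 2 / k * (k / 2 * e - w) ^ 2 := by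
      field_simp; ring
    have : 0 ≤ 2 / k * (k / 2 * e - w) ^ 2 := by positivity
    have h' : 2 / k * w ^ 2 ≤ 2 / k * εs := by gcongr
    linarith
  -- The price `ρ²‖g‖² e²` is exactly what the nonlinear damping of the control law supplies.
  have h3 : 2 * e * inner ℝ g ξ ≤ ρ ^ 2 * ‖g‖ ^ 2 * e ^ 2 + 1 / ρ ^ 2 * ‖ξ‖ ^ 2 := by
    have hc : (inner ℝ g ξ) ^ 2 ≤ (‖g‖ * ‖ξ‖) ^ 2 := sq_le_sq' (by
      have := (abs_le.1 (abs_real_inner_le_norm g ξ)).1; linarith) (real_inner_le_norm g ξ)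
    have h4 : 2 * e * inner ℝ g ξ ≤ 2 * (|e| * (‖g‖ * ‖ξ‖)) := by
      have := abs_real_inner_le_norm g ξ
      calc 2 * e * inner ℝ g ξ ≤ |2 * e * inner ℝ g ξ| := le_abs_self _
        _ = 2 * (|e| * |inner ℝ g ξ|) := by rw [abs_mul, abs_mul, abs_two]; ring
        _ ≤ _ := by gcongr
    have h5 : ρ ^ 2 * ‖g‖ ^ 2 * e ^ 2 + 1 / ρ ^ 2 * ‖ξ‖ ^ 2 - 2 * (|e| * (‖g‖ * ‖ξ‖))
        = (ρ * ‖g‖ * |e| - 1 / ρ * ‖ξ‖) ^ 2 := by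
      rw [← sq_abs e]; field_simp; ring
    have h6 := sq_nonneg (ρ * ‖g‖ * |e| - 1 / ρ * ‖ξ‖)
    linarith
  -- The first term cancels `2 e (θ - θ̂)ᵀφ` from the error equation; the second is the
  -- `σ`-modification.
  have h4 : γ⁻¹ * (2 * inner ℝ (θ - θh) (-(γ • (e • φ - σ • θh))))
      = -2 * e * inner ℝ (θ - θh) φ + 2 * σ * inner ℝ (θ - θh) θh := by
    rw [inner_neg_right, real_inner_smul_right, inner_sub_right, real_inner_smul_right,
      real_inner_smul_right]
    field_simp
    ring
  have h5 : 2 * σ * inner ℝ (θ - θh) θh ≤ -σ * ‖θ - θh‖ ^ 2 + σ * ‖θ‖ ^ 2 := by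
    have h : ‖θ‖ ^ 2 = ‖θ - θh‖ ^ 2 + 2 * inner ℝ (θ - θh) θh + ‖θh‖ ^ 2 := by
      rw [← norm_add_sq_real, sub_add_cancel]
    rw [h]
    nlinarith [sq_nonneg ‖θh‖, hσ]
  have h6 : inner ℝ (θ - θh) φ = inner ℝ θ φ - inner ℝ θh φ := inner_sub_left _ _ _
  have h7 : k * e ^ 2 ≤ K * e ^ 2 := by gcongr
  rw [h4, h6]
  linarith

/-- Shifting the index turns the left side into the right side without its term `q = 0`, since the
error after the last one is `0`. A geometric weight thus pays for all couplings at once. -/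
lemma sum_pow_mul_next_sq_le {n : ℕ} {β : ℝ} (e : (q : ℕ) → q < n → ℝ) :
    ∑ q : Fin n, β ^ (q : ℕ) * (β * (if h : (q : ℕ) + 1 < n then e (q + 1) h else 0) ^ 2)
      ≤ ∑ q : Fin n, β ^ (q : ℕ) * (e q q.isLt) ^ 2 := by
  set E : ℕ → ℝ := fun q => if h : q < n then e q h else 0
  have h1 : ∑ q : Fin n, β ^ (q : ℕ) * (e q q.isLt) ^ 2 = ∑ q ∈ Finset.range n, β ^ q * E q ^ 2 := by
    rw [← Fin.sum_univ_eq_sum_range (fun q => β ^ q * E q ^ 2)]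
    refine Finset.sum_congr rfl fun q _ => ?_
    simp only [E, dif_pos q.isLt]
  have h2 : ∑ q : Fin n, β ^ (q : ℕ) * (β * (if h : (q : ℕ) + 1 < n then e (q + 1) h else 0) ^ 2)
      = ∑ q ∈ Finset.range n, β ^ (q + 1) * E (q + 1) ^ 2 := by
    rw [← Fin.sum_univ_eq_sum_range (fun q => β ^ (q + 1) * E (q + 1) ^ 2)]
    refine Finset.sum_congr rfl fun q _ => ?_
    simp only [E, pow_succ]
    ring
  rw [h1, h2]
  have h3 := Finset.sum_range_succ' (fun q => β ^ q * E q ^ 2) n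
  rw [Finset.sum_range_succ] at h3
  have h4 : E n = 0 := dif_neg (lt_irrefl n)
  have h5 : 0 ≤ β ^ 0 * E 0 ^ 2 := by positivity
  rw [h4] at h3
  linarith

/-- The weighted quadratic Lyapunov function of the error system. -/
noncomputable def lyapunov (θ : Weights D.L) (β : ℝ) (s : State D.L) (η : Fin n → ℝ) : ℝ :=
  ∑ q : Fin n, β ^ (q : ℕ) *
    (err ag D s η q q.isLt ^ 2 + (D.gamma q)⁻¹ * ‖θ q - s.2 q‖ ^ 2)

lemma continuous_lyapunov (θ : Weights D.L) (β : ℝ) :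
    Continuous fun p : State D.L × (Fin n → ℝ) => lyapunov ag D θ β p.1 p.2 := by
  refine continuous_finsetSum _ fun q _ => ?_
  have h := (isTame_err ag D q q.isLt).1.continuous
  fun_prop

lemma exists_pos_le {ι : Type*} [Finite ι] (f : ι → ℝ) (hf : ∀ i, 0 < f i) :
    ∃ k, 0 < k ∧ ∀ i, k ≤ f i := by
  cases isEmpty_or_nonempty ι
  · exact ⟨1, one_pos, fun i => isEmptyElim i⟩
  · obtain ⟨i, hi⟩ := Finite.exists_min f
    exact ⟨f i, hf i, hi⟩

/-- Along every trajectory on which the approximation errors obey their bound, the Lyapunov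
function decays exponentially up to the energy of the noise and a constant. -/
theorem exists_lyapunov_deriv_le (hn : 2 ≤ n) (θ : Weights D.L) (εs : Fin n → ℝ) :
    ∃ β c C₁ C₂ : ℝ, 0 < β ∧ 0 < c ∧ 0 < C₁ ∧ 0 ≤ C₂ ∧
      ∀ (η : ℝ → Fin n → ℝ) (X : ℝ → State D.L) (ξ : EuclideanSpace ℝ (Fin m))
        (η' : Fin n → ℝ) (t : ℝ),
        HasDerivWithinAt X (closedLoop ag D (X t) (η t) ξ) (Ici t) t →
        HasDerivWithinAt η η' (Ici t) t →
        η' ⟨0, Nat.lt_of_lt_of_le Nat.zero_lt_two hn⟩ = η t ⟨1, hn⟩ →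
        (∀ q, |fbar ag D hn η X t q - inner ℝ (θ q) (phi D q (X t) (η t))| ^ 2 ≤ εs q) →
        ∃ V' : ℝ, HasDerivWithinAt (fun r => lyapunov ag D θ β (X r) (η r)) V' (Ici t) t ∧
          V' ≤ -c * lyapunov ag D θ β (X t) (η t) + (C₁ * ‖ξ‖ ^ 2 + C₂) := by
  obtain ⟨k, hk, hkK⟩ := exists_pos_le D.gain D.gain_pos
  obtain ⟨l, hl, hlσ⟩ := exists_pos_le (fun q => D.sigma q * D.gamma q)
    fun q => mul_pos (D.sigma_pos q) (D.gamma_pos q)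
  have : NeZero n := ⟨by omega⟩
  set β : ℝ := 4 / k ^ 2
  have hβ : 0 < β := by positivity
  -- The rate combines the damping `k / 2` left for the errors with the rate `σ γ` of the weight
  -- errors. The absolute value of `εs q` makes the constant nonnegative outright.
  refine ⟨β, min (k / 2) l, ∑ q : Fin n, β ^ (q : ℕ) * (1 / D.rho q ^ 2),
    ∑ q : Fin n, β ^ (q : ℕ) * (2 / k * |εs q| + D.sigma q * ‖θ q‖ ^ 2), hβ, lt_min (by positivity) hl,
    Finset.sum_pos (fun q _ => ?_) Finset.univ_nonempty, Finset.sum_nonneg fun q _ => ?_, ?_⟩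
  · have := D.rho_pos q; positivity
  · have := (D.sigma_pos q).le; positivity
  intro η X ξ η' t hX hη hη' hε
  have hderr := hasDerivWithinAt_err ag D hn hX hη hη'
  have hdw := hasDerivWithinAt_weight_error ag D θ hX
  refine ⟨_, HasDerivWithinAt.fun_sum fun q _ =>
    (((hderr q).fun_pow 2).add ((hdw q).norm_sq.const_mul (D.gamma q)⁻¹)).const_mul (β ^ (q : ℕ)), ?_⟩
  set e : Fin n → ℝ := fun q => err ag D (X t) (η t) q q.isLt
  set c := min (k / 2) l
  have hstep := fun q : Fin n => mul_le_mul_of_nonneg_left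
    (subsystem_dissipation (e := e q)
      (e' := nextErr ag D (X t) (η t) q) (g := ag.g q (partialState (X t).1 q)) (ξ := ξ)
      (θ := θ q) (θh := (X t).2 q) (φ := phi D q (X t) (η t)) (D.rho_pos q) (D.gamma_pos q)
      (D.sigma_pos q) hk (hkK q) ((hε q).trans (le_abs_self _))) (pow_pos hβ (q : ℕ)).le
  have hnext : ∑ q : Fin n, β ^ (q : ℕ) * (2 / k * nextErr ag D (X t) (η t) q ^ 2)
      ≤ ∑ q : Fin n, β ^ (q : ℕ) * (k / 2 * e q ^ 2) := by
    have h := mul_le_mul_of_nonneg_left (sum_pow_mul_next_sq_le (β := β)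
      fun q hq => err ag D (X t) (η t) q hq) (by positivity : 0 ≤ k / 2)
    rw [Finset.mul_sum, Finset.mul_sum] at h
    calc ∑ q : Fin n, β ^ (q : ℕ) * (2 / k * nextErr ag D (X t) (η t) q ^ 2)
        = ∑ q : Fin n, k / 2 * (β ^ (q : ℕ) * (β * nextErr ag D (X t) (η t) q ^ 2)) := by
          refine Finset.sum_congr rfl fun q _ => ?_
          have : 2 / k = k / 2 * β := by simp only [β]; field_simp; norm_num
          rw [this]; ring
      _ ≤ _ := h
      _ = _ := Finset.sum_congr rfl fun q _ => by simp only [e]; ring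
  have hdiss : ∀ q : Fin n, β ^ (q : ℕ) * (c * (e q ^ 2 + (D.gamma q)⁻¹ * ‖θ q - (X t).2 q‖ ^ 2))
      ≤ β ^ (q : ℕ) * (k / 2 * e q ^ 2 + D.sigma q * ‖θ q - (X t).2 q‖ ^ 2) := fun q => by
    have h1 : c * e q ^ 2 ≤ k / 2 * e q ^ 2 := by gcongr; exact min_le_left _ _
    have h2 : c * (D.gamma q)⁻¹ ≤ D.sigma q := by
      rw [← div_eq_mul_inv, div_le_iff₀ (D.gamma_pos q)]
      exact (min_le_right _ _).trans (hlσ q)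
    have h3 := mul_le_mul_of_nonneg_right h2 (sq_nonneg ‖θ q - (X t).2 q‖)
    gcongr
    linarith
  have hstep' := Finset.sum_le_sum fun q (_ : q ∈ Finset.univ) => hstep q
  have hdiss' := Finset.sum_le_sum fun q (_ : q ∈ Finset.univ) => hdiss q
  have hsplit : ∑ q : Fin n, β ^ (q : ℕ) * (-k * e q ^ 2 + 2 / k * nextErr ag D (X t) (η t) q ^ 2
        - D.sigma q * ‖θ q - (X t).2 q‖ ^ 2 + 1 / D.rho q ^ 2 * ‖ξ‖ ^ 2
        + (2 / k * |εs q| + D.sigma q * ‖θ q‖ ^ 2))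
      = -∑ q : Fin n, β ^ (q : ℕ) * (k / 2 * e q ^ 2 + D.sigma q * ‖θ q - (X t).2 q‖ ^ 2)
        + (∑ q : Fin n, β ^ (q : ℕ) * (2 / k * nextErr ag D (X t) (η t) q ^ 2)
          - ∑ q : Fin n, β ^ (q : ℕ) * (k / 2 * e q ^ 2))
        + ((∑ q : Fin n, β ^ (q : ℕ) * (1 / D.rho q ^ 2)) * ‖ξ‖ ^ 2
          + ∑ q : Fin n, β ^ (q : ℕ) * (2 / k * |εs q| + D.sigma q * ‖θ q‖ ^ 2)) := by
    rw [Finset.sum_mul, ← Finset.sum_neg_distrib, ← Finset.sum_sub_distrib,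
      ← Finset.sum_add_distrib, ← Finset.sum_add_distrib, ← Finset.sum_add_distrib]
    exact Finset.sum_congr rfl fun q _ => by ring
  have hlyap : c * lyapunov ag D θ β (X t) (η t)
      = ∑ q : Fin n, β ^ (q : ℕ) * (c * (e q ^ 2 + (D.gamma q)⁻¹ * ‖θ q - (X t).2 q‖ ^ 2)) := by
    rw [lyapunov, Finset.mul_sum]
    exact Finset.sum_congr rfl fun q _ => by simp only [e]; ring
  refine (le_of_eq (Finset.sum_congr rfl fun q _ => ?_)).trans
    (hstep'.trans (hsplit.le.trans ?_))
  · simp only [e]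
    push_cast
    ring
  · rw [neg_mul, hlyap]
    linarith

end Lyapunov

/-! ### A priori bounds -/

section Bounds

variable {n m : ℕ} (ag : Agent n m) (D : Design n)

/-- Bounded errors bound the state recursively: `x_{q+1} = e_{q+1} + α_q`, and `α_q` sees the plant
state only through `g_q` at the components already bounded, apart from `e_q` and the Gaussians,
which are bounded anyway. Hence `g` needs no growth condition. -/
lemma exists_plant_state_bound (A : ℝ) (k : ℕ) :
    ∃ R : ℝ, ∀ (s : State D.L) (η : Fin n → ℝ), (∀ q : Fin n, |err ag D s η q q.isLt| ≤ A) →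
      (∀ q, ‖s.2 q‖ ≤ A) → (∀ j, |η j| ≤ A) → ∀ q : Fin n, (q : ℕ) ≤ k → |s.1 q| ≤ R := by
  induction k with
  | zero =>
    refine ⟨A + A, fun s η he _ hη q hq => ?_⟩
    obtain ⟨q, hqn⟩ := q
    obtain rfl : q = 0 := Nat.le_zero.1 hq
    have h : s.1 ⟨0, hqn⟩ = err ag D s η 0 hqn + η ⟨0, hqn⟩ := by simp [err]
    rw [h]
    exact (abs_add_le _ _).trans (add_le_add (he ⟨0, hqn⟩) (hη ⟨0, hqn⟩))
  | succ k ih =>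
    obtain ⟨R, hR⟩ := ih
    by_cases hk : k + 1 < n
    · set p : Fin n := ⟨k, Nat.lt_of_succ_lt hk⟩
      obtain ⟨G, hG⟩ := (isCompact_closedBall (0 : Fin ((p : ℕ) + 1) → ℝ) (max R 0)).exists_bound_of_continuousOn
        (ag.g_differentiable p).continuous.continuousOn
      refine ⟨max R (A + ((D.gain p + D.rho p ^ 2 / 2 * G ^ 2) * A + A * Real.sqrt (D.L p))),
        fun s η he hθ hη q hq => ?_⟩
      rcases Nat.lt_or_ge q (k + 1) with hlt | hge
      · exact (hR s η he hθ hη q (Nat.le_of_lt_succ hlt)).trans (le_max_left _ _)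
      · obtain ⟨q, hqn⟩ := q
        obtain rfl : q = k + 1 := le_antisymm hq hge
        refine le_trans ?_ (le_max_right _ _)
        have hA : 0 ≤ A := (abs_nonneg _).trans (he p)
        have hgp : ‖ag.g p (partialState s.1 p)‖ ≤ G := by
          refine hG _ (mem_closedBall_zero_iff.2 ((pi_norm_le_iff_of_nonneg (le_max_right _ _)).2
            fun j => ?_))
          refine (hR s η he hθ hη (Fin.castLE p.isLt j) ?_).trans (le_max_left _ _)
          exact Nat.le_of_lt_succ j.isLt
        have hgain := (D.gain_pos p).le
        have hx : s.1 ⟨k + 1, hqn⟩ = err ag D s η (k + 1) hqn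
            + (-((D.gain p + D.rho p ^ 2 / 2 * ‖ag.g p (partialState s.1 p)‖ ^ 2)
              * err ag D s η k p.isLt) - inner ℝ (s.2 p) (phi D p s η)) := by
          rw [err, controlLaw]
          ring
        rw [hx]
        refine (abs_add_le _ _).trans (add_le_add (he ⟨k + 1, hqn⟩) ?_)
        refine (abs_sub _ _).trans (add_le_add ?_ ?_)
        · rw [abs_neg, abs_mul, abs_of_nonneg (by positivity)]
          gcongr
          exact he p
        · refine (abs_real_inner_le_norm _ _).trans ?_
          gcongr
          · exact hθ p
          · exact norm_phi_le D p s η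
    · refine ⟨R, fun s η he hθ hη q _ => hR s η he hθ hη q ?_⟩
      have := q.isLt
      omega

lemma exists_state_bound (A : ℝ) :
    ∃ M : ℝ, ∀ (s : State D.L) (η : Fin n → ℝ), (∀ q : Fin n, |err ag D s η q q.isLt| ≤ A) →
      (∀ q, ‖s.2 q‖ ≤ A) → (∀ j, |η j| ≤ A) → ‖s‖ ≤ M := by
  obtain ⟨R, hR⟩ := exists_plant_state_bound ag D A n
  refine ⟨max (max R A) 0, fun s η he hθ hη => ?_⟩
  have h0 : 0 ≤ max (max R A) 0 := le_max_right _ _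
  refine norm_prod_le_iff.2 ⟨(pi_norm_le_iff_of_nonneg h0).2 fun q => ?_,
    (pi_norm_le_iff_of_nonneg h0).2 fun q => ?_⟩
  · exact (hR s η he hθ hη q q.isLt.le).trans ((le_max_left _ _).trans (le_max_left _ _))
  · exact (hθ q).trans ((le_max_right _ _).trans (le_max_left _ _))

lemma norm_errVec_sq (θ : Weights D.L) (s : State D.L) (η : Fin n → ℝ) :
    ‖errVec ag D θ s η‖ ^ 2 = ∑ q : Fin n, (err ag D s η q q.isLt ^ 2 + ‖θ q - s.2 q‖ ^ 2) := by
  rw [errVec, WithLp.prod_norm_sq_eq_of_L2, Finset.sum_add_distrib]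
  congr 1
  · exact EuclideanSpace.real_norm_sq_eq _
  · exact PiLp.norm_sq_eq_of_L2 _ _

lemma abs_err_le_norm_errVec (θ : Weights D.L) (s : State D.L) (η : Fin n → ℝ) (q : Fin n) :
    |err ag D s η q q.isLt| ≤ ‖errVec ag D θ s η‖ := by
  refine abs_le_of_sq_le_sq ?_ (norm_nonneg _)
  rw [norm_errVec_sq]
  refine le_trans ?_ (Finset.single_le_sum (f := fun q : Fin n =>
    err ag D s η q q.isLt ^ 2 + ‖θ q - s.2 q‖ ^ 2) (fun q _ => by positivity) (Finset.mem_univ q))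
  exact le_add_of_nonneg_right (sq_nonneg _)

lemma norm_weight_error_le_norm_errVec (θ : Weights D.L) (s : State D.L) (η : Fin n → ℝ)
    (q : Fin n) : ‖θ q - s.2 q‖ ≤ ‖errVec ag D θ s η‖ := by
  refine (sq_le_sq₀ (norm_nonneg _) (norm_nonneg _)).1 ?_
  rw [norm_errVec_sq]
  refine le_trans ?_ (Finset.single_le_sum (f := fun q : Fin n =>
    err ag D s η q q.isLt ^ 2 + ‖θ q - s.2 q‖ ^ 2) (fun q _ => by positivity) (Finset.mem_univ q))
  exact le_add_of_nonneg_left (sq_nonneg _)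

lemma exists_lyapunov_bounds (θ : Weights D.L) {β : ℝ} (hβ : 0 < β) :
    ∃ l M : ℝ, 0 < l ∧ 0 < M ∧ ∀ (s : State D.L) (η : Fin n → ℝ),
      l * ‖errVec ag D θ s η‖ ^ 2 ≤ lyapunov ag D θ β s η ∧
        lyapunov ag D θ β s η ≤ M * ‖errVec ag D θ s η‖ ^ 2 := by
  have hγ : ∀ q, 0 < (D.gamma q)⁻¹ := fun q => inv_pos.2 (D.gamma_pos q)
  obtain ⟨l₁, hl₁, h₁⟩ := exists_pos_le (fun q : Fin n => β ^ (q : ℕ)) fun q => pow_pos hβ _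
  obtain ⟨l₂, hl₂, h₂⟩ := exists_pos_le (fun q : Fin n => β ^ (q : ℕ) * (D.gamma q)⁻¹)
    fun q => mul_pos (pow_pos hβ _) (hγ q)
  have hterm : ∀ q : Fin n, 0 ≤ β ^ (q : ℕ) + β ^ (q : ℕ) * (D.gamma q)⁻¹ := fun q =>
    add_nonneg (pow_pos hβ _).le (mul_pos (pow_pos hβ _) (hγ q)).le
  refine ⟨min l₁ l₂, ∑ q : Fin n, (β ^ (q : ℕ) + β ^ (q : ℕ) * (D.gamma q)⁻¹) + 1,
    lt_min hl₁ hl₂, add_pos_of_nonneg_of_pos (Finset.sum_nonneg fun q _ => hterm q) one_pos,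
    fun s η => ?_⟩
  rw [norm_errVec_sq, Finset.mul_sum, Finset.mul_sum, lyapunov]
  refine ⟨Finset.sum_le_sum fun q _ => ?_, Finset.sum_le_sum fun q _ => ?_⟩
  · have e1 : min l₁ l₂ * err ag D s η q q.isLt ^ 2 ≤ β ^ (q : ℕ) * err ag D s η q q.isLt ^ 2 := by
      gcongr; exact (min_le_left _ _).trans (h₁ q)
    have e2 : min l₁ l₂ * ‖θ q - s.2 q‖ ^ 2
        ≤ β ^ (q : ℕ) * (D.gamma q)⁻¹ * ‖θ q - s.2 q‖ ^ 2 := by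
      gcongr; exact (min_le_right _ _).trans (h₂ q)
    linarith
  · have hle := Finset.single_le_sum (f := fun q : Fin n =>
      β ^ (q : ℕ) + β ^ (q : ℕ) * (D.gamma q)⁻¹) (fun q _ => hterm q) (Finset.mem_univ q)
    have hβq := (pow_pos hβ (q : ℕ)).le
    have hβγ := (mul_pos (pow_pos hβ (q : ℕ)) (hγ q)).le
    set W := ∑ q : Fin n, (β ^ (q : ℕ) + β ^ (q : ℕ) * (D.gamma q)⁻¹) + 1
    have e1 : β ^ (q : ℕ) * err ag D s η q q.isLt ^ 2 ≤ W * err ag D s η q q.isLt ^ 2 := by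
      gcongr; linarith
    have e2 : β ^ (q : ℕ) * (D.gamma q)⁻¹ * ‖θ q - s.2 q‖ ^ 2 ≤ W * ‖θ q - s.2 q‖ ^ 2 := by
      gcongr; linarith
    linarith

lemma continuousOn_lyapunov_comp (θ : Weights D.L) (β : ℝ) {η : ℝ → Fin n → ℝ}
    {X : ℝ → State D.L} {S : Set ℝ} (hX : ContinuousOn X S) (hη : ContinuousOn η S) :
    ContinuousOn (fun r => lyapunov ag D θ β (X r) (η r)) S := by
  have h := continuous_lyapunov ag D θ β
  generalize lyapunov ag D θ β = F at *
  exact h.comp_continuousOn (hX.prodMk hη)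

/-- The value of the Lyapunov function along closed-loop trajectories. -/
theorem exists_lyapunov_le (hn : 2 ≤ n) (θ : Weights D.L) (εs : Fin n → ℝ) :
    ∃ β c C₁ C₂ : ℝ, 0 < β ∧ 0 < c ∧ 0 < C₁ ∧ 0 ≤ C₂ ∧
      ∀ (η : ℝ → Fin n → ℝ) (ξ : ℝ → EuclideanSpace ℝ (Fin m)), ContinuousOn η (Ici 0) →
        (∀ t, 0 ≤ t → ∃ η' : Fin n → ℝ, HasDerivWithinAt η η' (Ici t) t ∧
          η' ⟨0, Nat.lt_of_lt_of_le Nat.zero_lt_two hn⟩ = η t ⟨1, hn⟩) →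
        ContinuousOn ξ (Ici 0) → ∀ (b : ℝ) (X : ℝ → State D.L),
        IsSolution ag D η ξ (Ico 0 b) X →
        (∀ t ∈ Ico 0 b, ∀ q,
          |fbar ag D hn η X t q - inner ℝ (θ q) (phi D q (X t) (η t))| ^ 2 ≤ εs q) →
        ∀ t ∈ Ico 0 b, lyapunov ag D θ β (X t) (η t)
          ≤ Real.exp (-c * t) * lyapunov ag D θ β (X 0) (η 0)
            + ∫ r in 0..t, Real.exp (-c * (t - r)) * (C₁ * ‖ξ (max r 0)‖ ^ 2 + C₂) := by
  obtain ⟨β, c, C₁, C₂, hβ, hc, hC₁, hC₂, h⟩ := exists_lyapunov_deriv_le ag D hn θ εs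
  refine ⟨β, c, C₁, C₂, hβ, hc, hC₁, hC₂, fun η ξ hηc hηd hξ b X hX hε t ht => ?_⟩
  have hex : ∀ r, ∃ V' : ℝ, r ∈ Ico 0 b →
      HasDerivWithinAt (fun r => lyapunov ag D θ β (X r) (η r)) V' (Ici r) r ∧
        V' ≤ -c * lyapunov ag D θ β (X r) (η r) + (C₁ * ‖ξ r‖ ^ 2 + C₂) := by
    intro r
    by_cases hr : r ∈ Ico 0 b
    · obtain ⟨η', hη', hη0⟩ := hηd r hr.1
      have hXr : HasDerivWithinAt X (closedLoop ag D (X r) (η r) (ξ r)) (Ici r) r :=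
        (hX r hr).mono_of_mem_nhdsWithin
        (mem_of_superset (Ico_mem_nhdsGE hr.2) (Ico_subset_Ico_left hr.1))
      obtain ⟨V', hV', hle⟩ := h η X (ξ r) η' r hXr hη' hη0 (hε r hr)
      exact ⟨V', fun _ => ⟨hV', hle⟩⟩
    · exact ⟨0, fun h => absurd h hr⟩
  choose V' hV' using hex
  have hXc : ContinuousOn X (Ico 0 b) := fun r hr => (hX r hr).continuousWithinAt
  have hcont := continuousOn_lyapunov_comp ag D θ β hXc (hηc.mono Ico_subset_Ici_self)
  -- The noise is continuous only on `[0, ∞)`; `max r 0` extends it continuously to all of `ℝ`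
  -- without changing the integrals from `0` to `t ≥ 0`.
  have hk : Continuous fun r => C₁ * ‖ξ (max r 0)‖ ^ 2 + C₂ :=
    (continuous_const.mul ((continuous_comp_max_zero hξ).norm.pow 2)).add continuous_const
  refine le_exp_mul_add_integral (V := fun r => lyapunov ag D θ β (X r) (η r)) (V' := V') hk hcont
    (fun r hr => (hV' r hr).1) (fun r hr => ?_) ht
  rw [max_eq_left hr.1]
  exact (hV' r hr).2

/-- An estimate of the Lyapunov function gives an a priori bound of the closed-loop state. -/
lemma exists_a_priori_bound (θ : Weights D.L) {β c : ℝ} (hβ : 0 < β) (hc : 0 < c)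
    {k : ℝ → ℝ} (hk : Continuous k) {η : ℝ → Fin n → ℝ} (hη : ContinuousOn η (Ici 0))
    (V₀ T : ℝ) :
    ∃ M : ℝ, ∀ t ∈ Icc 0 T, ∀ s : State D.L,
      lyapunov ag D θ β s (η t)
          ≤ Real.exp (-c * t) * V₀ + ∫ r in 0..t, Real.exp (-c * (t - r)) * k r →
        ‖s‖ ≤ M := by
  obtain ⟨B, hB⟩ := isCompact_Icc.exists_bound_of_continuousOn (hk.continuousOn (s := Icc 0 T))
  obtain ⟨Bη, hBη⟩ := isCompact_Icc.exists_bound_of_continuousOn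
    (hη.mono (Icc_subset_Ici_self : Icc 0 T ⊆ Ici 0))
  obtain ⟨l, _, hl, _, hlM⟩ := exists_lyapunov_bounds ag D θ hβ
  set A₀ := Real.sqrt ((|V₀| + |B| * (1 / c)) / l)
  obtain ⟨M, hM⟩ := exists_state_bound ag D (max (A₀ + ‖θ‖) Bη)
  refine ⟨M, fun t ht s hs => ?_⟩
  have hint : ∫ r in 0..t, Real.exp (-c * (t - r)) * k r ≤ |B| * (1 / c) := by
    calc ∫ r in 0..t, Real.exp (-c * (t - r)) * k r
        ≤ ∫ r in 0..t, |B| * Real.exp (-c * (t - r)) := by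
          refine intervalIntegral.integral_mono_on ht.1
            ((by fun_prop : Continuous fun r => Real.exp (-c * (t - r)) * k r).intervalIntegrable _ _)
            ((by fun_prop : Continuous fun r =>
              |B| * Real.exp (-c * (t - r))).intervalIntegrable _ _) fun r hr => ?_
          rw [mul_comm]
          gcongr
          exact ((le_abs_self _).trans (hB r ⟨hr.1, hr.2.trans ht.2⟩)).trans (le_abs_self _)
      _ = |B| * ∫ r in 0..t, Real.exp (-c * (t - r)) := intervalIntegral.integral_const_mul _ _
      _ ≤ |B| * (1 / c) := by gcongr; exact integral_exp_neg_mul_sub_le hc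
  have hexp : Real.exp (-c * t) * V₀ ≤ |V₀| := by
    have h1 : Real.exp (-c * t) ≤ 1 := Real.exp_le_one_iff.2 (by nlinarith [ht.1])
    calc Real.exp (-c * t) * V₀ ≤ Real.exp (-c * t) * |V₀| := by gcongr; exact le_abs_self _
      _ ≤ 1 * |V₀| := by gcongr
      _ = |V₀| := one_mul _
  have hE : ‖errVec ag D θ s (η t)‖ ≤ A₀ := by
    refine Real.le_sqrt_of_sq_le ?_
    rw [le_div_iff₀ hl]
    linarith [(hlM s (η t)).1]
  refine hM s (η t) (fun q => ?_) (fun q => ?_) (fun j => ?_)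
  · exact ((abs_err_le_norm_errVec ag D θ s (η t) q).trans hE).trans
      ((le_add_of_nonneg_right (norm_nonneg _)).trans (le_max_left _ _))
  · refine le_trans ?_ (le_max_left _ _)
    have h1 : s.2 q = θ q - (θ q - s.2 q) := by abel
    have h2 := (norm_weight_error_le_norm_errVec ag D θ s (η t) q).trans hE
    rw [h1]
    refine (norm_sub_le _ _).trans ?_
    have h3 : ‖θ q‖ ≤ ‖θ‖ := norm_le_pi_norm θ q
    linarith
  · exact ((norm_le_pi_norm (η t) j).trans (hBη t ht)).trans (le_max_right _ _)

end Bounds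

/-! ### Stability in probability and tracking -/

section Stability

/-- As `n ≥ 2`, the first entry of `B` vanishes, so the switching signal does not reach `η_1'`. -/
lemma IsAuxiliary.deriv_zero {N n : ℕ} (hn : 2 ≤ n) {a : Matrix (Fin N) (Fin N) ℝ}
    {b : Fin N → ℝ} {zr : ℝ → ℝ} {τ τe : ℕ → ℝ} {c0 : ℕ} {P : Matrix (Fin n) (Fin n) ℝ}
    {η : Fin N → ℝ → (Fin n → ℝ)} (hη : IsAuxiliary a b zr τ τe (gainK c0 P) η) (i : Fin N)
    {t : ℝ} (ht : 0 ≤ t) :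
    ∃ η' : Fin n → ℝ, HasDerivWithinAt (η i) η' (Ici t) t ∧
      η' ⟨0, Nat.lt_of_lt_of_le Nat.zero_lt_two hn⟩ = η i t ⟨1, hn⟩ := by
  refine ⟨_, (hη i).2 t ht, ?_⟩
  have h1 : (0 : ℕ) + 1 < n := hn
  rw [chainB_mul_gainK_mulVec, Pi.add_apply, chainA_mulVec_apply, dif_pos h1, Pi.smul_apply]
  have h2 : inputVec n ⟨0, Nat.lt_of_lt_of_le Nat.zero_lt_two hn⟩ = 0 := by
    simp only [inputVec, chainB, Matrix.of_apply]
    exact if_neg h1.ne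
  rw [h2, smul_zero, add_zero]

lemma isClassKL_mul_exp {A c : ℝ} (hA : 0 < A) (hc : 0 < c) :
    IsClassKL fun s t => A * Real.exp (-c * t) * s := by
  refine ⟨fun t _ => ⟨by fun_prop, fun x _ y _ hxy => ?_, by simp⟩, fun s hs t _ t' _ htt => ?_,
    fun s _ => ?_⟩
  · have : 0 < A * Real.exp (-c * t) := by positivity
    exact mul_lt_mul_of_pos_left hxy this
  · have hs' : (0 : ℝ) ≤ s := hs
    have : -c * t' ≤ -c * t := by nlinarith
    change A * Real.exp (-c * t') * s ≤ A * Real.exp (-c * t) * s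
    gcongr
  · have h1 : Tendsto (fun t : ℝ => Real.exp (-c * t)) atTop (𝓝 0) :=
      Real.tendsto_exp_atBot.comp (tendsto_id.const_mul_atTop_of_neg (neg_lt_zero.2 hc))
    simpa using (h1.const_mul A).mul_const s

lemma isClassK_sqrt_mul {A : ℝ} (hA : 0 < A) : IsClassK fun u => Real.sqrt (A * u) := by
  refine ⟨by fun_prop, fun x hx y _ hxy => ?_, by simp⟩
  have hx' : (0 : ℝ) ≤ x := hx
  exact Real.sqrt_lt_sqrt (by positivity) (mul_lt_mul_of_pos_left hxy hA)

variable {Ω : Type*} {mΩ : MeasurableSpace Ω} {Pr : Measure Ω}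

/-- Markov's inequality at level `A / l0`. By subadditivity `S` itself need not be measurable. -/
lemma one_sub_le_measure_of_lintegral_le [IsProbabilityMeasure Pr]
    {J : Ω → ℝ} (hJ : Measurable J) {A l0 : ℝ} (hA : 0 < A)
    (hl0 : 0 < l0) (hle : ∫⁻ ω, ENNReal.ofReal (J ω) ∂Pr ≤ ENNReal.ofReal A) {S : Set Ω}
    (hS : ∀ ω, J ω < A / l0 → ω ∈ S) : ENNReal.ofReal (1 - l0) ≤ Pr S := by
  have hpos : 0 < A / l0 := by positivity
  have hmarkov : Pr Sᶜ ≤ ENNReal.ofReal l0 := by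
    calc Pr Sᶜ ≤ Pr {ω | ENNReal.ofReal (A / l0) ≤ ENNReal.ofReal (J ω)} := by
          refine measure_mono fun ω hω => ?_
          exact ENNReal.ofReal_le_ofReal (not_lt.1 fun h => hω (hS ω h))
      _ ≤ (∫⁻ ω, ENNReal.ofReal (J ω) ∂Pr) / ENNReal.ofReal (A / l0) :=
          meas_ge_le_lintegral_div (ENNReal.measurable_ofReal.comp hJ).aemeasurable
            (by simpa using hpos) ENNReal.ofReal_ne_top
      _ ≤ ENNReal.ofReal A / ENNReal.ofReal (A / l0) := by gcongr
      _ = ENNReal.ofReal l0 := by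
          rw [← ENNReal.ofReal_div_of_pos hpos]
          congr 1
          field_simp
  rw [ENNReal.ofReal_sub _ hl0.le, ENNReal.ofReal_one, tsub_le_iff_right]
  calc (1 : ENNReal) = Pr univ := measure_univ.symm
    _ = Pr (S ∪ Sᶜ) := by rw [union_compl_self]
    _ ≤ Pr S + Pr Sᶜ := measure_union_le _ _
    _ ≤ Pr S + ENNReal.ofReal l0 := by gcongr

variable {n m : ℕ} {ag : Agent n m} {D : Design n} {ℱ : Filtration ℝ mΩ}
  {ξ : ℝ → Ω → EuclideanSpace ℝ (Fin m)} {ξs : ℝ}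

/-- The exponentially weighted energy of the noise. -/
noncomputable def noiseEnergy (ξ : ℝ → Ω → EuclideanSpace ℝ (Fin m)) (c t : ℝ) (ω : Ω) : ℝ :=
  ∫ r in 0..t, Real.exp (-c * (t - r)) * ‖ξ (max r 0) ω‖ ^ 2

lemma IsColoredNoise.continuous_max (hξ : IsColoredNoise Pr ℱ ξ ξs) (ω : Ω) :
    Continuous fun r => ξ (max r 0) ω :=
  continuous_comp_max_zero (hξ.continuous ω)

lemma IsColoredNoise.measurable_max (hξ : IsColoredNoise Pr ℱ ξ ξs) (r : ℝ) :
    Measurable (ξ (max r 0)) :=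
  (hξ.adapted _ (le_max_right r 0)).mono (ℱ.le _) le_rfl

lemma IsColoredNoise.measurable_noiseEnergy (hξ : IsColoredNoise Pr ℱ ξ ξs) (c t : ℝ) :
    Measurable (noiseEnergy ξ c t) := by
  refine measurable_intervalIntegral_of_continuous
    (Φ := fun r ω => Real.exp (-c * (t - r)) * ‖ξ (max r 0) ω‖ ^ 2) (fun ω => ?_) (fun r => ?_) t
  · exact (by fun_prop : Continuous fun r => Real.exp (-c * (t - r))).mul
      ((hξ.continuous_max ω).norm.pow 2)
  · exact ((hξ.measurable_max r).norm.pow_const 2).const_mul _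

lemma IsColoredNoise.lintegral_noiseEnergy_le [IsProbabilityMeasure Pr]
    (hξ : IsColoredNoise Pr ℱ ξ ξs) {c t : ℝ}
    (hc : 0 < c) (ht : 0 ≤ t) :
    ∫⁻ ω, ENNReal.ofReal (noiseEnergy ξ c t ω) ∂Pr ≤ ENNReal.ofReal (ξs / c) :=
  lintegral_integral_exp_mul_sq_le hξ.continuous_max hξ.measurable_max
    (fun r => hξ.moment _ (le_max_right r 0)) hc ht

lemma noiseEnergy_nonneg (c : ℝ) {t : ℝ} (ht : 0 ≤ t) (ω : Ω) : 0 ≤ noiseEnergy ξ c t ω :=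
  intervalIntegral.integral_nonneg ht fun r _ => by positivity

lemma IsColoredNoise.integral_supply_le (hξ : IsColoredNoise Pr ℱ ξ ξs) {c C₁ C₂ : ℝ}
    (hc : 0 < c) (hC₂ : 0 ≤ C₂) (t : ℝ) (ω : Ω) :
    ∫ r in 0..t, Real.exp (-c * (t - r)) * (C₁ * ‖ξ (max r 0) ω‖ ^ 2 + C₂)
      ≤ C₁ * noiseEnergy ξ c t ω + C₂ / c := by
  have hcont := hξ.continuous_max ω
  have h1 : ∫ r in 0..t, Real.exp (-c * (t - r)) * (C₁ * ‖ξ (max r 0) ω‖ ^ 2 + C₂)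
      = C₁ * noiseEnergy ξ c t ω + C₂ * ∫ r in 0..t, Real.exp (-c * (t - r)) := by
    rw [noiseEnergy, ← intervalIntegral.integral_const_mul, ← intervalIntegral.integral_const_mul,
      ← intervalIntegral.integral_add]
    · congr 1 with r; ring
    · exact (continuous_const.mul ((by fun_prop : Continuous fun r =>
        Real.exp (-c * (t - r))).mul (hcont.norm.pow 2))).intervalIntegrable _ _
    · exact (by fun_prop : Continuous fun r =>
        C₂ * Real.exp (-c * (t - r))).intervalIntegrable _ _
  rw [h1, div_eq_mul_one_div]
  gcongr
  exact integral_exp_neg_mul_sub_le hc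

/-- The closed loop of one agent has unique global adapted solutions, along which the error vector
is bounded by an exponentially decaying term, the energy of the noise, and a constant. -/
theorem exists_closedLoop_solution (hn : 2 ≤ n) {η : ℝ → Fin n → ℝ}
    (hηc : ContinuousOn η (Ici 0))
    (hηd : ∀ t, 0 ≤ t → ∃ η' : Fin n → ℝ, HasDerivWithinAt η η' (Ici t) t ∧
      η' ⟨0, Nat.lt_of_lt_of_le Nat.zero_lt_two hn⟩ = η t ⟨1, hn⟩)
    (hξ : IsColoredNoise Pr ℱ ξ ξs) {S : Set (State D.L)} {θ : Weights D.L} {εs : Fin n → ℝ}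
    (happrox : IsApproximation ag D hn η ξ S θ εs) :
    ∃ X : State D.L → ℝ → Ω → State D.L,
      (∀ s ∈ S, (∀ t, 0 ≤ t → Measurable[ℱ t] (X s t)) ∧ ∀ ω, X s 0 ω = s ∧
        IsSolution ag D η (fun t => ξ t ω) (Ici 0) (fun t => X s t ω) ∧
        ∀ (c : ℝ) (Y : ℝ → State D.L), 0 < c →
          IsSolution ag D η (fun t => ξ t ω) (Ico 0 c) Y → Y 0 = s →
          ∀ t ∈ Ico 0 c, Y t = X s t ω) ∧
      ∃ c A C₁ C₂ : ℝ, 0 < c ∧ 0 < A ∧ 0 < C₁ ∧ 0 ≤ C₂ ∧ ∀ s ∈ S, ∀ t, 0 ≤ t → ∀ ω,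
        ‖errVec ag D θ (X s t ω) (η t)‖ ^ 2
          ≤ A * Real.exp (-c * t) * ‖errVec ag D θ s (η 0)‖ ^ 2
            + (C₁ * noiseEnergy ξ c t ω + C₂) := by
  obtain ⟨β, c, C₁, C₂, hβ, hc, hC₁, hC₂, hV⟩ := exists_lyapunov_le ag D hn θ εs
  obtain ⟨l, M, hl, hM, hlM⟩ := exists_lyapunov_bounds ag D θ hβ
  have hsol : ∀ s, ∃ X : ℝ → Ω → State D.L, s ∈ S →
      (∀ t, 0 ≤ t → Measurable[ℱ t] (X t)) ∧ ∀ ω, X 0 ω = s ∧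
        IsSolution ag D η (fun t => ξ t ω) (Ici 0) (fun t => X t ω) ∧
        ∀ (c : ℝ) (Y : ℝ → State D.L), 0 < c →
          IsSolution ag D η (fun t => ξ t ω) (Ico 0 c) Y → Y 0 = s →
          ∀ t ∈ Ico 0 c, Y t = X t ω := by
    intro s
    by_cases hs : s ∈ S
    · obtain ⟨X, hX⟩ := exists_adapted_solution ℱ (locallyLipschitz_closedLoop ag D)
        (w := fun t ω => (η t, ξ t ω)) (fun ω => hηc.prodMk (hξ.continuous ω))
        (fun t ht => measurable_const.prodMk (hξ.adapted t ht)) s (fun ω T _ => by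
          have hk : Continuous fun r => C₁ * ‖ξ (max r 0) ω‖ ^ 2 + C₂ :=
            (continuous_const.mul ((hξ.continuous_max ω).norm.pow 2)).add continuous_const
          obtain ⟨B, hB⟩ := exists_a_priori_bound ag D θ hβ hc hk hηc
            (lyapunov ag D θ β s (η 0)) T
          -- The approximation hypothesis is used on `[0, b)` only, so the bound applies to
          -- solutions not yet known to be global.
          refine ⟨B, fun b hb X hX hX0 t ht => hB t ⟨ht.1, ht.2.le.trans hb.2⟩ (X t) ?_⟩
          have h := hV η (fun t => ξ t ω) hηc hηd (hξ.continuous ω) b X hX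
            (happrox ω b hb.1 X hX (hX0 ▸ hs)) t ht
          rwa [hX0] at h)
      exact ⟨X, fun _ => hX⟩
    · exact ⟨fun _ _ => s, fun h => absurd h hs⟩
  choose X hX using hsol
  refine ⟨X, hX, c, M / l, C₁ / l, C₂ / c / l, hc, by positivity, by positivity, by positivity,
    fun s hs t ht ω => ?_⟩
  obtain ⟨-, hXω⟩ := hX s hs
  obtain ⟨h0, hsolω, -⟩ := hXω ω
  have hIco : IsSolution ag D η (fun t => ξ t ω) (Ico 0 (t + 1)) (fun t => X s t ω) :=
    fun r hr => (hsolω r hr.1).mono Ico_subset_Ici_self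
  have h := hV η (fun t => ξ t ω) hηc hηd (hξ.continuous ω) (t + 1) (fun t => X s t ω) hIco
    (happrox ω (t + 1) (by linarith) _ hIco (h0.symm ▸ hs)) t ⟨ht, by linarith⟩
  have h1 := (hlM (X s t ω) (η t)).1
  have h2 := (hlM s (η 0)).2
  have h3 := hξ.integral_supply_le hc hC₂ (C₁ := C₁) t ω
  rw [h0] at h
  have h4 := mul_le_mul_of_nonneg_left h2 (Real.exp_pos (-c * t)).le
  have h5 : M / l * Real.exp (-c * t) * ‖errVec ag D θ s (η 0)‖ ^ 2
      + (C₁ / l * noiseEnergy ξ c t ω + C₂ / c / l)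
      = (Real.exp (-c * t) * (M * ‖errVec ag D θ s (η 0)‖ ^ 2)
        + (C₁ * noiseEnergy ξ c t ω + C₂ / c)) / l := by
    field_simp
  rw [h5, le_div_iff₀ hl]
  linarith

/-- A process whose square is bounded by a decaying term, the energy of the noise, and a constant
is noise-to-state practically stable in probability. -/
lemma nSpSP_of_sq_le [IsProbabilityMeasure Pr]
    (hξ : IsColoredNoise Pr ℱ ξ ξs) {ι E : Type*} [NormedAddCommGroup E]
    {S : Set ι} {Y : ι → ℝ → Ω → E} {c A C₁ C₂ : ℝ} (hc : 0 < c) (hA : 0 < A) (hC₁ : 0 < C₁)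
    (hC₂ : 0 ≤ C₂)
    (hY : ∀ s ∈ S, ∀ t, 0 ≤ t → ∀ ω,
      ‖Y s t ω‖ ^ 2 ≤ A * Real.exp (-c * t) * ‖Y s 0 ω‖ ^ 2
        + (C₁ * noiseEnergy ξ c t ω + C₂)) :
    NSpSP Pr ξs S Y := by
  have hξs := hξ.bound_pos
  -- Neither constant depends on `l0`; the confidence level enters only through the factor `1 / l0 +
  -- 1` in `d`, where `1 / l0` pays for Markov's inequality and `1` for the constant `C₂`.
  refine ⟨C₁ / c, C₂, by positivity, hC₂, fun l0 hl0 =>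
    ⟨fun s t => Real.sqrt A * Real.exp (-(c / 2) * t) * s,
      fun u => Real.sqrt ((1 / l0 + 1) * u),
      isClassKL_mul_exp (Real.sqrt_pos.2 hA) (by positivity), isClassK_sqrt_mul (by positivity),
      fun s hs t ht => one_sub_le_measure_of_lintegral_le (hξ.measurable_noiseEnergy c t)
        (by positivity) hl0 (hξ.lintegral_noiseEnergy_le hc ht) fun ω hω => ?_⟩⟩
  have hJ : C₁ * noiseEnergy ξ c t ω + C₂ ≤ (1 / l0 + 1) * (C₁ / c * ξs + C₂) := by
    have h1 : C₁ * noiseEnergy ξ c t ω ≤ C₁ * (ξs / c / l0) := by gcongr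
    have h2 : (1 / l0 + 1) * (C₁ / c * ξs + C₂)
        = C₁ * (ξs / c / l0) + C₂ + (1 / l0 * C₂ + C₁ / c * ξs) := by field_simp; ring
    have h3 : 0 ≤ 1 / l0 * C₂ + C₁ / c * ξs := by positivity
    linarith
  have hsq : (Real.sqrt A * Real.exp (-(c / 2) * t) * ‖Y s 0 ω‖) ^ 2
      = A * Real.exp (-c * t) * ‖Y s 0 ω‖ ^ 2 := by
    rw [mul_pow, mul_pow, Real.sq_sqrt hA.le, ← Real.exp_nat_mul]
    congr 3
    push_cast
    ring
  have hu : 0 ≤ (1 / l0 + 1) * (C₁ / c * ξs + C₂) := by positivity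
  -- The square of the claimed bound exceeds the available estimate by a nonnegative cross term.
  refine abs_le_of_sq_le_sq' (le_trans (hY s hs t ht ω) ?_) (by positivity) |>.2
  rw [add_sq, hsq, Real.sq_sqrt hu]
  have : 0 ≤ 2 * (Real.sqrt A * Real.exp (-(c / 2) * t) * ‖Y s 0 ω‖)
      * Real.sqrt ((1 / l0 + 1) * (C₁ / c * ξs + C₂)) := by positivity
  linarith

/-- A scalar process at distance at most `M` from one whose square is bounded by a decaying term,
the energy of the noise, and a constant is ultimately bounded in mean. -/
lemma limsup_lintegral_lt_of_sq_le [IsProbabilityMeasure Pr]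
    (hξ : IsColoredNoise Pr ℱ ξ ξs) {y e : ℝ → Ω → ℝ}
    {c A C₁ C₂ M : ℝ} (hc : 0 < c) (hC₁ : 0 < C₁) (hC₂ : 0 ≤ C₂)
    (hM : 0 ≤ M) (hy : ∀ t, 0 ≤ t → ∀ ω, |y t ω| ≤ |e t ω| + M)
    (he : ∀ t, 0 ≤ t → ∀ ω,
      e t ω ^ 2 ≤ A * Real.exp (-c * t) + (C₁ * noiseEnergy ξ c t ω + C₂)) :
    limsup (fun t : ℝ => ∫⁻ ω, ‖y t ω‖ₑ ∂Pr) atTop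
      < ENNReal.ofReal (3 + M + C₂ + C₁ * (ξs / c)) := by
  have hξs := hξ.bound_pos
  have hdecay : Tendsto (fun t : ℝ => A * Real.exp (-c * t)) atTop (𝓝 0) := by
    have h1 : Tendsto (fun t : ℝ => Real.exp (-c * t)) atTop (𝓝 0) :=
      Real.tendsto_exp_atBot.comp (tendsto_id.const_mul_atTop_of_neg (neg_lt_zero.2 hc))
    simpa using h1.const_mul A
  have hev : ∀ᶠ t : ℝ in atTop,
      ∫⁻ ω, ‖y t ω‖ₑ ∂Pr ≤ ENNReal.ofReal (2 + M + C₂ + C₁ * (ξs / c)) := by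
    -- Eventually the decaying term is at most `1`; with `|e| ≤ 1 + e²` this gives the constant `2`.
    -- The `3` in the statement makes the final inequality strict.
    filter_upwards [eventually_ge_atTop (0 : ℝ), hdecay.eventually_le_const one_pos] with t ht hd
    have hpt : ∀ ω, ‖y t ω‖ₑ
        ≤ ENNReal.ofReal C₁ * ENNReal.ofReal (noiseEnergy ξ c t ω)
          + ENNReal.ofReal (2 + M + C₂) := fun ω => by
      rw [← ENNReal.ofReal_mul hC₁.le, ← ENNReal.ofReal_add
        (mul_nonneg hC₁.le (noiseEnergy_nonneg c ht ω)) (by positivity), Real.enorm_eq_ofReal_abs]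
      refine ENNReal.ofReal_le_ofReal ?_
      have h1 := he t ht ω
      have h2 := hy t ht ω
      have h3 : |e t ω| ≤ 1 + e t ω ^ 2 := by
        rw [← sq_abs]; nlinarith [sq_nonneg (|e t ω| - 1), abs_nonneg (e t ω)]
      linarith
    calc ∫⁻ ω, ‖y t ω‖ₑ ∂Pr
        ≤ ∫⁻ ω, (ENNReal.ofReal C₁ * ENNReal.ofReal (noiseEnergy ξ c t ω)
          + ENNReal.ofReal (2 + M + C₂)) ∂Pr := lintegral_mono hpt
      _ = ENNReal.ofReal C₁ * ∫⁻ ω, ENNReal.ofReal (noiseEnergy ξ c t ω) ∂Pr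
          + ENNReal.ofReal (2 + M + C₂) := by
          rw [lintegral_add_right _ measurable_const,
            lintegral_const_mul' _ _ ENNReal.ofReal_ne_top]
          simp
      _ ≤ ENNReal.ofReal C₁ * ENNReal.ofReal (ξs / c) + ENNReal.ofReal (2 + M + C₂) := by
          gcongr
          exact hξ.lintegral_noiseEnergy_le hc ht
      _ = ENNReal.ofReal (2 + M + C₂ + C₁ * (ξs / c)) := by
          rw [← ENNReal.ofReal_mul hC₁.le, ← ENNReal.ofReal_add (by positivity) (by positivity)]
          congr 1
          ring
  refine (limsup_le_of_le (by isBoundedDefault) hev).trans_lt ?_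
  exact (ENNReal.ofReal_lt_ofReal_iff (by positivity)).2 (by linarith)

end Stability

end IntermittentMAS

theorem theorem2 {N n m : ℕ} (hn : 2 ≤ n)
    -- network, leader and communication schedule
    (a : Matrix (Fin N) (Fin N) ℝ) (b : Fin N → ℝ) (hnet : IntermittentMAS.IsNetwork a b)
    (zr : ℝ → ℝ) (cz : ℝ) (hzr : IntermittentMAS.IsLeader n zr cz)
    (τ τe : ℕ → ℝ) (T : ℝ) (hτ : IntermittentMAS.IsSchedule τ τe T)
    -- design of the auxiliary trajectories
    (P : Matrix (Fin n) (Fin n) ℝ) (c0 : ℕ) (c1 c2 c3 : ℝ)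
    (hc0 : 0 < c0) (hc1 : 0 < c1) (hc2 : 0 < c2) (hc3 : 0 < c3)
    (hP : IntermittentMAS.IsRiccati P c1 c3)
    (hgain : 1 ≤ (c0 : ℝ) *
      IntermittentMAS.lambdaMin (IntermittentMAS.laplacian a + Matrix.diagonal b))
    (hcond : ∀ κ : ℕ,
      0 < (IntermittentMAS.deltaOn N P cz c1 c2 + IntermittentMAS.deltaOff N cz c2 c3)
            * (τe κ - τ κ)
          - IntermittentMAS.deltaOff N cz c2 c3 * (τ (κ + 1) - τ κ))
    (η : Fin N → ℝ → (Fin n → ℝ))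
    (hη : IntermittentMAS.IsAuxiliary a b zr τ τe (IntermittentMAS.gainK c0 P) η)
    -- noise
    {Ω : Type*} {mΩ : MeasurableSpace Ω} (Pr : MeasureTheory.Measure Ω)
    [MeasureTheory.IsProbabilityMeasure Pr] (ℱ : MeasureTheory.Filtration ℝ mΩ)
    (ξ : Fin N → ℝ → Ω → EuclideanSpace ℝ (Fin m)) (ξs : Fin N → ℝ)
    (hξ : ∀ i, IntermittentMAS.IsColoredNoise Pr ℱ (ξ i) (ξs i))
    -- agents, control design and neural approximation
    (ag : Fin N → IntermittentMAS.Agent n m) (D : Fin N → IntermittentMAS.Design n)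
    (S : (i : Fin N) → Set (IntermittentMAS.State (D i).L))
    (θ : (i : Fin N) → IntermittentMAS.Weights (D i).L) (εs : Fin N → Fin n → ℝ)
    (happrox : ∀ i,
      IntermittentMAS.IsApproximation (ag i) (D i) hn (η i) (ξ i) (S i) (θ i) (εs i)) :
    ∀ i : Fin N,
      ∃ X : IntermittentMAS.State (D i).L → ℝ → Ω → IntermittentMAS.State (D i).L,
        -- for each initial condition there is a unique global solution, and it is adapted
        (∀ s ∈ S i,
          (∀ t, 0 ≤ t → Measurable[ℱ t] (X s t)) ∧
          ∀ ω, X s 0 ω = s ∧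
            IntermittentMAS.IsSolution (ag i) (D i) (η i) (fun t => ξ i t ω) (Set.Ici 0)
              (fun t => X s t ω) ∧
            ∀ (c : ℝ) (Y : ℝ → IntermittentMAS.State (D i).L), 0 < c →
              IntermittentMAS.IsSolution (ag i) (D i) (η i) (fun t => ξ i t ω) (Set.Ico 0 c) Y →
              Y 0 = s → ∀ t ∈ Set.Ico 0 c, Y t = X s t ω) ∧
        -- the errors are noise-to-state practically stable in probability
        IntermittentMAS.NSpSP Pr (ξs i) (S i)
          (fun s t ω => IntermittentMAS.errVec (ag i) (D i) (θ i) (X s t ω) (η i t)) ∧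
        -- tracking consensus with the leader
        ∃ ε : ℝ, 0 < ε ∧ ∀ s ∈ S i,
          Filter.limsup
            (fun t : ℝ => ∫⁻ ω, ‖(X s t ω).1 ⟨0, Nat.lt_of_lt_of_le Nat.zero_lt_two hn⟩ - zr t‖ₑ ∂Pr)
            Filter.atTop < ENNReal.ofReal ε := by
  intro i
  have : NeZero N := ⟨(Fin.pos i).ne'⟩
  have : NeZero n := ⟨by omega⟩
  obtain ⟨M, hM⟩ := IntermittentMAS.exists_bound_auxiliary_sub_leaderVec hnet hzr hτ hc1 hc2 hP
    hgain hcond hη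
  obtain ⟨X, hX, c, A, C₁, C₂, hc, hA, hC₁, hC₂, hE⟩ :=
    IntermittentMAS.exists_closedLoop_solution hn (hη i).1 (fun t ht => hη.deriv_zero hn i ht)
      (hξ i) (happrox i)
  have hξs := (hξ i).bound_pos
  have hM0 : 0 ≤ M := (abs_nonneg _).trans (hM 0 le_rfl i 0)
  refine ⟨X, hX, IntermittentMAS.nSpSP_of_sq_le (hξ i) hc hA hC₁ hC₂ fun s hs t ht ω => ?_,
    3 + M + C₂ + C₁ * (ξs i / c), by positivity, fun s hs => ?_⟩
  · rw [((hX s hs).2 ω).1]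
    exact hE s hs t ht ω
  -- The initial error enters only the coefficient of the decaying exponential, so the same `ε`
  -- serves all initial conditions.
  · refine IntermittentMAS.limsup_lintegral_lt_of_sq_le (hξ i)
      (e := fun t ω => IntermittentMAS.err (ag i) (D i) (X s t ω) (η i t) 0
        (Nat.lt_of_lt_of_le Nat.zero_lt_two hn))
      (A := A * ‖IntermittentMAS.errVec (ag i) (D i) (θ i) s (η i 0)‖ ^ 2) hc hC₁ hC₂ hM0
      (fun t ht ω => ?_) (fun t ht ω => ?_)
    · have h1 := hM t ht i ⟨0, Nat.lt_of_lt_of_le Nat.zero_lt_two hn⟩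
      simp only [IntermittentMAS.leaderVec, iteratedDeriv_zero] at h1
      refine le_trans ?_ (add_le_add_right h1 _)
      rw [IntermittentMAS.err]
      exact abs_sub_le _ _ _
    · have h1 := IntermittentMAS.abs_err_le_norm_errVec (ag i) (D i) (θ i) (X s t ω) (η i t)
        ⟨0, Nat.lt_of_lt_of_le Nat.zero_lt_two hn⟩
      have h2 := hE s hs t ht ω
      have h3 := pow_le_pow_left₀ (abs_nonneg _) h1 2
      rw [sq_abs] at h3
      refine h3.trans (h2.trans_eq ?_)
      ring
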